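/- Let $\mathbb E$ be Minkowski $(2+1)$-space: the affine space $\mathbb R^3$ with the inner product $\mathbb B(x,y)=x_1y_1+x_2y_2-x_3y_3$ on its vectors. Let $\mathcal N_+=\{x:\mathbb B(x,x)<0,\ x_3>0\}$, let $SO^0(2,1)$ be the group of linear isometries of $\mathbb B$ that preserve the orientation and $\mathcal N_+$, and let $\mathrm{Isom}^0(\mathbb E)$ be the group of affine maps of $\mathbb E$ with linear part in $SO^0(2,1)$. Let $$\mathcal C_0=\{x_1\le 0,\ x_2=x_3\}\cup\{x_1=0,\ |x_2|\le|x_3|\}\cup\{x_1\ge 0,\ x_2=-x_3\}.$$ For a vector $u$ with $\mathbb B(u,u)=1$ and a point $p\in\mathbb E$, the crooked plane with direction $u$ and vertex $p$ is $\mathcal C(u,p)=p+g(\mathcal C_0)$, where $g\in SO^0(2,1)$ maps $(1,0,0)$ to $u$ (the set does not depend on the choice of $g$). The crooked half-space $\mathcal H(u,p)$ is the connected component of $\mathbb E-\mathcal C(u,p)$ that contains $p+\{x\in\mathcal N_+:\mathbb B(x,u)>0\}$. **Theorem (Drumm).** Let $\mathcal C_1^-,\mathcal C_1^+,\dots,\mathcal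 C_m^-,\mathcal C_m^+$ be crooked planes bounding crooked half-spaces $\mathcal H_1^-,\mathcal H_1^+,\dots,\mathcal H_m^-,\mathcal H_m^+$ (that is, $\mathcal C_i^\pm=\mathcal C(u_i^\pm,p_i^\pm)$ and $\mathcal H_i^\pm=\mathcal H(u_i^\pm,p_i^\pm)$), and let $h_1,\dots,h_m\in\mathrm{Isom}^0(\mathbb E)$, such that the $2m$ crooked planes are pairwise disjoint, the $2m$ crooked half-spaces are pairwise disjoint, and $h_i(\mathcal H_i^-)=\mathbb E-\overline{\mathcal H_i^+}$ for every $i$. Let $\Gamma=\langle h_1,\dots,h_m\rangle$ and $X=\mathbb E-\bigcup_{i=1}^m(\overline{\mathcal H_i^+}\cup\overline{\mathcal H_i^-})$. Then: 1. $\Gamma$ acts properly discontinuously on $\mathbb E$: for all compact $K,L\subset\mathbb E$, only finitely many $\gamma\in\Gamma$ satisfy $\gamma K\cap L\ne\emptyset$; 2. $X$ is a fundamental domain for the action of $\Gamma$ on $\mathbb E$: $X$ is open, the sets $\gamma X$ ($\gamma\in\Gamma$) are pairwise disjoint, $\bigcup_{\gamma\in\Gamma}\gamma\overline X=\mathbb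 E$, and every compact set meets only finitely many of the sets $\gamma\overline X$; 3. $\Gamma$ is free on $h_1,\dots,h_m$. -/

import Mathlib

namespace Crooked

/-- Minkowski (2+1)-space, with an origin chosen: the points are identified with the vectors of
`ℝ³`. The coordinates `u₁, u₂, u₃` are `u 0, u 1, u 2`. Only the topology and the affine structure
of `Fin 3 → ℝ` are used, together with the Lorentzian inner product `B` below. -/
abbrev E : Type := Fin 3 → ℝ

/-- The Lorentzian inner product `u₁ v₁ + u₂ v₂ - u₃ v₃`. -/
def B (u v : E) : ℝ := u 0 * v 0 + u 1 * v 1 - u 2 * v 2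

/-- The future: timelike vectors with positive third coordinate. -/
def future : Set E := {u | B u u < 0 ∧ 0 < u 2}

/-- The unit-spacelike vectors. -/
def unitSpacelike : Set E := {u | B u u = 1}

/-- `SO⁰(2,1)`: the linear isometries preserving the orientation and the future. -/
def SO0 : Subgroup (E ≃ₗ[ℝ] E) where
  carrier := {g | (∀ u v, B (g u) (g v) = B u v) ∧ LinearEquiv.det g = 1 ∧
    ∀ u, g u ∈ future ↔ u ∈ future}
  one_mem' := ⟨fun _ _ => rfl, map_one _, fun _ => Iff.rfl⟩
  mul_mem' := by
    rintro g h ⟨hg, hg', hg''⟩ ⟨hh, hh', hh''⟩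
    refine ⟨fun u v => ?_, by rw [map_mul, hg', hh', one_mul], fun u => ?_⟩
    · rw [LinearEquiv.mul_apply, LinearEquiv.mul_apply, hg, hh]
    · rw [LinearEquiv.mul_apply, hg'', hh'']
  inv_mem' := by
    rintro g ⟨hg, hg', hg''⟩
    have key : ∀ u, g (g⁻¹ u) = u := fun u => g.apply_symm_apply u
    refine ⟨fun u v => ?_, by rw [map_inv, hg', inv_one], fun u => ?_⟩
    · rw [← hg, key, key]
    · rw [← hg'', key]

/-- `Isom⁰(𝔼) = SO⁰(2,1) ⋉ V`: the affine bijections whose linear part lies in `SO⁰(2,1)`. -/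
def Isom0 : Subgroup (E ≃ᵃ[ℝ] E) := SO0.comap AffineEquiv.linearHom

/-- The unit-spacelike vector directing the model crooked plane. -/
def e1 : E := ![1, 0, 0]

/-- The stem of the model crooked plane. -/
def stem0 : Set E := {x | x 0 = 0 ∧ |x 1| ≤ |x 2|}

/-- The wing `𝒲⁻` of the model crooked plane. -/
def wingNeg0 : Set E := {x | x 0 ≤ 0 ∧ x 1 = x 2}

/-- The wing `𝒲⁺` of the model crooked plane. -/
def wingPos0 : Set E := {x | 0 ≤ x 0 ∧ x 1 = -x 2}

/-- The model crooked plane, directed by `e1` and with vertex the origin. -/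
def crookedPlane0 : Set E := wingNeg0 ∪ stem0 ∪ wingPos0

/-- The crooked plane `𝒞(u, p) = p + g(𝒞₀)` directed by the unit-spacelike vector `u`, with vertex
`p`, where `g ∈ SO⁰(2,1)` satisfies `g e1 = u`. (The stabilizer of `e1` in `SO⁰(2,1)` preserves
`𝒞₀`, so all such `g` give the same set.) -/
def crookedPlane (u p : E) : Set E :=
  {x | ∃ g ∈ SO0, g e1 = u ∧ ∃ y ∈ crookedPlane0, x = p + g y}

/-- The cone over the half-plane of the hyperbolic plane determined by `u`. -/
def halfPlaneCone (u : E) : Set E := {x | x ∈ future ∧ 0 < B x u}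

/-- The crooked half-space `ℋ(u, p)`: the component of the complement of the crooked plane
`𝒞(u, p)` that contains the connected set `p + halfPlaneCone u`. -/
def crookedHalfSpace (u p : E) : Set E :=
  {x | ∃ y ∈ halfPlaneCone u, x ∈ connectedComponentIn (crookedPlane u p)ᶜ (p + y)}

/-- The group `Γ` acts properly discontinuously on `𝔼`. -/
def ActsProperlyDiscontinuously (Γ : Subgroup (E ≃ᵃ[ℝ] E)) : Prop :=
  ∀ K L : Set E, IsCompact K → IsCompact L →
    {γ : E ≃ᵃ[ℝ] E | γ ∈ Γ ∧ ((γ '' K) ∩ L).Nonempty}.Finite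

/-- `X` is a (locally finite) fundamental domain for the action of `Γ` on `𝔼`: an open set with
pairwise disjoint translates, the translates of whose closure cover `𝔼` and form a locally finite
family. -/
structure IsFundamentalDomain (Γ : Subgroup (E ≃ᵃ[ℝ] E)) (X : Set E) : Prop where
  isOpen : IsOpen X
  disjoint : ∀ γ ∈ Γ, ∀ γ' ∈ Γ, γ ≠ γ' → Disjoint (γ '' X) (γ' '' X)
  covers : ⋃ γ ∈ Γ, γ '' closure X = Set.univ
  locallyFinite : ∀ K : Set E, IsCompact K →
    {γ : E ≃ᵃ[ℝ] E | γ ∈ Γ ∧ ((γ '' closure X) ∩ K).Nonempty}.Finite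

end Crooked

namespace Crooked

open Filter Topology

/-! ### Lorentzian linear algebra -/

/-! Freeness and the disjointness of the translates of `X` are ping-pong: the generator or inverse
indexed by `k` carries the complement of one closed half-space onto `H k`, so a nonempty reduced
word sends `X` into the half-space of its first letter (`reducedWord_apply_mem`). Once the
translates of the closed polyhedron `Y` are known to cover, local finiteness is a check near points
of `Y`, and proper discontinuity follows.

The hard point is covering (`exists_apply_mem_Y`): no invariant metric prevents nested half-spaces
from accumulating. The proof reads a vector `t` as an infinitesimal isometry of the hyperbolic
plane. For future null vectors `n`, `n'`, the ratio of `det3 t n n'` to `-B n n'` is the rate at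
which `t` contracts the geodesic with these ends; it is linear in `t` and invariant under `SO0`.

If two closed crooked half-spaces are disjoint, the difference of their vertices contracts every
geodesic from one half-plane to the other at a rate at least some `ε > 0` (`exists_contraction`).
Indeed each closed half-space contains a null half-plane through its vertex for every null direction
in its closed hyperbolic half-plane (`add_mem_closure_halfSpace`), and a rate of the wrong sign
would make two of these null half-planes meet (`B_spinorProd_ne_zero`). Compactness makes the rate
uniform, including where the ends collide, because writing null vectors as squares of spinors lets
the vanishing factor be divided out.

If the orbit of `x` avoids `Y`, pulling `x` out of successive half-spaces writes `x - p` as a sum of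
`N` vertex differences, moved by linear parts, and a remainder that contributes nonnegatively
(`exists_null_det3_nonneg`). For a fixed future `q` this yields a splitting `q = n + n'` with `det3
(x - p) n n'` at least `N * ε * (-B q q / 2)` (`exists_large_contraction`). The splittings of `q`
form a bounded set, so the determinant is bounded (`det3_le`), a contradiction for large `N`. -/

lemma B_add_left (x y z : E) : B (x + y) z = B x z + B y z := by simp [B]; ring
lemma B_add_right (x y z : E) : B x (y + z) = B x y + B x z := by simp [B]; ring
lemma B_sub_left (x y z : E) : B (x - y) z = B x z - B y z := by simp [B]; ring
lemma B_sub_right (x y z : E) : B x (y - z) = B x y - B x z := by simp [B]; ring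
lemma B_smul_left (c : ℝ) (x y : E) : B (c • x) y = c * B x y := by simp [B]; ring
lemma B_smul_right (c : ℝ) (x y : E) : B x (c • y) = c * B x y := by simp [B]; ring
lemma B_neg_left (x y : E) : B (-x) y = -B x y := by simp [B]; ring
lemma B_neg_right (x y : E) : B x (-y) = -B x y := by simp [B]; ring
lemma B_comm (x y : E) : B x y = B y x := by simp [B]; ring

lemma B_e1 (x : E) : B x e1 = x 0 := by simp [B, e1]

/-- The determinant of three vectors. -/
def det3 (x y z : E) : ℝ :=
  x 0 * (y 1 * z 2 - y 2 * z 1) + x 1 * (y 2 * z 0 - y 0 * z 2) + x 2 * (y 0 * z 1 - y 1 * z 0)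

lemma det3_eq_basis_det (x y z : E) :
    det3 x y z = (Pi.basisFun ℝ (Fin 3)).det ![x, y, z] := by
  rw [Pi.basisFun_det_apply, Matrix.det_fin_three]
  simp [det3]
  ring

lemma det3_map (f : E →ₗ[ℝ] E) (x y z : E) :
    det3 (f x) (f y) (f z) = LinearMap.det f * det3 x y z := by
  rw [det3_eq_basis_det, det3_eq_basis_det, ← Module.Basis.det_comp]
  congr 1
  ext i
  fin_cases i <;> rfl

lemma linearMap_det_eq_det3 (f : E →ₗ[ℝ] E) :
    LinearMap.det f = det3 (f ![1, 0, 0]) (f ![0, 1, 0]) (f ![0, 0, 1]) := by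
  rw [det3_map]
  simp [det3]

lemma det3_add_left (x x' y z : E) : det3 (x + x') y z = det3 x y z + det3 x' y z := by
  simp [det3]; ring

/-- Two vectors in the closed future cone have nonpositive inner product. -/
lemma B_neg_of_future_of_causal {a b : E} (ha : a ∈ future) (hb : B b b ≤ 0) (hb2 : 0 < b 2) :
    B a b < 0 := by
  obtain ⟨h1, h2⟩ := ha
  simp only [B] at *
  have h3 : (a 0 * b 0 + a 1 * b 1) ^ 2 < (a 2 * b 2) ^ 2 := by
    have e : (a 0 * b 0 + a 1 * b 1) ^ 2 ≤ (a 0 ^ 2 + a 1 ^ 2) * (b 0 ^ 2 + b 1 ^ 2) := by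
      nlinarith [sq_nonneg (a 0 * b 1 - a 1 * b 0)]
    have e2 : (a 0 ^ 2 + a 1 ^ 2) * (b 0 ^ 2 + b 1 ^ 2) ≤ (a 0 ^ 2 + a 1 ^ 2) * b 2 ^ 2 := by
      gcongr; nlinarith
    have e3 : (a 0 ^ 2 + a 1 ^ 2) * b 2 ^ 2 < a 2 ^ 2 * b 2 ^ 2 := by
      have : 0 < b 2 ^ 2 := by positivity
      gcongr; nlinarith
    nlinarith
  have := abs_lt_of_sq_lt_sq h3 (by positivity)
  linarith [(abs_lt.1 this).2]

lemma pos_of_B_neg {a b : E} (ha : a ∈ future) (hb : B b b ≤ 0) (hab : B a b < 0) : 0 < b 2 := by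
  rcases lt_trichotomy (b 2) 0 with h | h | h
  · have := B_neg_of_future_of_causal (b := -b) ha (by simpa [B_neg_left, B_neg_right] using hb)
      (by simpa using h)
    rw [B_neg_right] at this
    linarith
  · simp only [B, h] at hb hab
    have h0 : b 0 = 0 := by nlinarith [sq_nonneg (b 0), sq_nonneg (b 1)]
    have h1 : b 1 = 0 := by nlinarith [sq_nonneg (b 0), sq_nonneg (b 1)]
    simp [h0, h1] at hab
  · exact h

lemma e3_mem_future : (![0, 0, 1] : E) ∈ future := by simp [future, B]

/-! ### The group `SO⁰(2,1)` -/

lemma SO0_B {g : E ≃ₗ[ℝ] E} (hg : g ∈ SO0) (x y : E) : B (g x) (g y) = B x y := hg.1 x y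

lemma SO0_future {g : E ≃ₗ[ℝ] E} (hg : g ∈ SO0) {x : E} (hx : x ∈ future) : g x ∈ future :=
  (hg.2.2 x).2 hx

lemma SO0_det3 {g : E ≃ₗ[ℝ] E} (hg : g ∈ SO0) (x y z : E) :
    det3 (g x) (g y) (g z) = det3 x y z := by
  have := det3_map (g : E →ₗ[ℝ] E) x y z
  rw [← LinearEquiv.coe_det, hg.2.1] at this
  simpa using this

lemma SO0_pos {g : E ≃ₗ[ℝ] E} (hg : g ∈ SO0) {x : E} (hx : B x x ≤ 0) (hx2 : 0 < x 2) :
    0 < g x 2 := by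
  have h := B_neg_of_future_of_causal e3_mem_future hx hx2
  rw [← SO0_B hg] at h
  exact pos_of_B_neg (SO0_future hg e3_mem_future) (by rwa [SO0_B hg]) h

lemma apply_inv_apply (g : E ≃ₗ[ℝ] E) (x : E) : g (g⁻¹ x) = x := g.apply_symm_apply x
lemma inv_apply_apply (g : E ≃ₗ[ℝ] E) (x : E) : g⁻¹ (g x) = x := g.symm_apply_apply x

lemma SO0_B_inv {g : E ≃ₗ[ℝ] E} (hg : g ∈ SO0) (x y : E) : B (g⁻¹ x) y = B x (g y) := by
  rw [← SO0_B hg, apply_inv_apply]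

/-- One vector suffices to test time orientation: a timelike vector is future exactly when its
product with a given future vector is negative, and `g` preserves products. -/
lemma mem_SO0_of {g : E ≃ₗ[ℝ] E} (hB : ∀ x y, B (g x) (g y) = B x y)
    (hdet : det3 (g ![1, 0, 0]) (g ![0, 1, 0]) (g ![0, 0, 1]) = 1) (hpos : 0 < g ![0, 0, 1] 2) :
    g ∈ SO0 := by
  have hf : g ![0, 0, 1] ∈ future := ⟨by rw [hB]; exact e3_mem_future.1, hpos⟩
  refine ⟨hB, ?_, fun x => ⟨fun hx => ?_, fun hx => ?_⟩⟩
  · ext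
    rw [LinearEquiv.coe_det, linearMap_det_eq_det3]
    simpa using hdet
  · have h := B_neg_of_future_of_causal hf hx.1.le hx.2
    have hx1 := hx.1
    rw [hB] at h hx1
    exact ⟨hx1, pos_of_B_neg e3_mem_future hx1.le h⟩
  · have h := B_neg_of_future_of_causal e3_mem_future hx.1.le hx.2
    rw [← hB] at h
    exact ⟨by rw [hB]; exact hx.1, pos_of_B_neg hf (by rw [hB]; exact hx.1.le) h⟩

/-- The rotation about the third axis with cosine `c` and sine `s`. -/
def rotation (c s : ℝ) (h : c ^ 2 + s ^ 2 = 1) : E ≃ₗ[ℝ] E where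
  toFun x := ![c * x 0 - s * x 1, s * x 0 + c * x 1, x 2]
  invFun x := ![c * x 0 + s * x 1, -s * x 0 + c * x 1, x 2]
  map_add' x y := by ext i; fin_cases i <;> simp <;> ring
  map_smul' a x := by ext i; fin_cases i <;> simp <;> ring
  left_inv x := by
    ext i
    fin_cases i
    · simp; linear_combination x 0 * h
    · simp; linear_combination x 1 * h
    · simp
  right_inv x := by
    ext i
    fin_cases i
    · simp; linear_combination x 0 * h
    · simp; linear_combination x 1 * h
    · simp

/-- The boost in the plane of the first and third axes. -/
def boost (r c : ℝ) (h : r ^ 2 - c ^ 2 = 1) : E ≃ₗ[ℝ] E where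
  toFun x := ![r * x 0 + c * x 2, x 1, c * x 0 + r * x 2]
  invFun x := ![r * x 0 - c * x 2, x 1, -c * x 0 + r * x 2]
  map_add' x y := by ext i; fin_cases i <;> simp <;> ring
  map_smul' a x := by ext i; fin_cases i <;> simp <;> ring
  left_inv x := by
    ext i
    fin_cases i
    · simp; linear_combination x 0 * h
    · simp
    · simp; linear_combination x 2 * h
  right_inv x := by
    ext i
    fin_cases i
    · simp; linear_combination x 0 * h
    · simp
    · simp; linear_combination x 2 * h

lemma rotation_apply (c s : ℝ) (h : c ^ 2 + s ^ 2 = 1) (x : E) :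
    rotation c s h x = ![c * x 0 - s * x 1, s * x 0 + c * x 1, x 2] := rfl

lemma boost_apply (r c : ℝ) (h : r ^ 2 - c ^ 2 = 1) (x : E) :
    boost r c h x = ![r * x 0 + c * x 2, x 1, c * x 0 + r * x 2] := rfl

lemma rotation_mem (c s : ℝ) (h : c ^ 2 + s ^ 2 = 1) : rotation c s h ∈ SO0 := by
  refine mem_SO0_of (fun x y => ?_) ?_ ?_
  · simp [rotation_apply, B]; linear_combination (x 0 * y 0 + x 1 * y 1) * h
  · simp [rotation_apply, det3]; linear_combination h
  · simp [rotation_apply]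

lemma boost_mem (r c : ℝ) (h : r ^ 2 - c ^ 2 = 1) (hr : 0 < r) : boost r c h ∈ SO0 := by
  refine mem_SO0_of (fun x y => ?_) ?_ ?_
  · simp [boost_apply, B]; linear_combination (x 0 * y 0 - x 2 * y 2) * h
  · simp [boost_apply, det3]; linear_combination h
  · simpa [boost_apply] using hr

/-- `SO⁰(2,1)` acts transitively on the unit-spacelike vectors. -/
lemma exists_SO0_e1 {u : E} (hu : u ∈ unitSpacelike) : ∃ g ∈ SO0, g e1 = u := by
  have hu' : u 0 * u 0 + u 1 * u 1 - u 2 * u 2 = 1 := hu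
  set r := √(u 0 ^ 2 + u 1 ^ 2) with hr
  have hr2 : r ^ 2 = u 0 ^ 2 + u 1 ^ 2 := Real.sq_sqrt (by positivity)
  have hr0 : 0 < r := Real.sqrt_pos.2 (by nlinarith [sq_nonneg (u 2)])
  have h1 : (u 0 / r) ^ 2 + (u 1 / r) ^ 2 = 1 := by field_simp; linarith
  have h2 : r ^ 2 - u 2 ^ 2 = 1 := by nlinarith
  refine ⟨rotation _ _ h1 * boost _ _ h2, mul_mem (rotation_mem _ _ h1) (boost_mem _ _ h2 hr0), ?_⟩
  rw [LinearEquiv.mul_apply, boost_apply, rotation_apply]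
  ext i
  fin_cases i
  · simp [e1]; field_simp
  · simp [e1]; field_simp
  · simp [e1]

/-- An element of `SO⁰(2,1)` fixing `e1` is a boost in the plane of the other two axes. -/
lemma SO0_fix_e1 {s : E ≃ₗ[ℝ] E} (hs : s ∈ SO0) (h1 : s e1 = e1) :
    ∃ l m : ℝ, 0 < l ∧ 0 < m ∧ ∀ x, s x 0 = x 0 ∧ s x 1 + s x 2 = l * (x 1 + x 2) ∧
      s x 1 - s x 2 = m * (x 1 - x 2) := by
  set v := s ![0, 1, 0] with hv
  set w := s ![0, 0, 1] with hw
  have hx0 : ∀ x, s x 0 = x 0 := fun x => by rw [← B_e1 (s x), ← B_e1 x, ← SO0_B hs x e1, h1]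
  have hv0 : v 0 = 0 := by rw [hv, hx0]; simp
  have hw0 : w 0 = 0 := by rw [hw, hx0]; simp
  have hvv : B v v = 1 := by rw [hv, SO0_B hs]; simp [B]
  have hww : B w w = -1 := by rw [hw, SO0_B hs]; simp [B]
  have hvw : B v w = 0 := by rw [hv, hw, SO0_B hs]; simp [B]
  have hw2 : 0 < w 2 := (SO0_future hs e3_mem_future).2
  have hdet : det3 e1 v w = 1 := by
    have : det3 (s e1) v w = 1 := by rw [hv, hw, SO0_det3 hs]; simp [det3, e1]
    rwa [h1] at this
  simp only [B, hv0, hw0, det3, e1] at hvv hww hvw hdet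
  simp at hdet
  have e1' : v 1 = w 2 := by linear_combination w 2 * hdet + v 1 * hww - w 1 * hvw
  have e2' : v 2 = w 1 := by
    have : w 2 * (v 2 - w 1) = 0 := by rw [e1'] at hvw; linear_combination -hvw
    rcases mul_eq_zero.1 this with h | h <;> linarith
  have hsx : ∀ x, s x = x 0 • e1 + x 1 • v + x 2 • w := fun x => by
    conv_lhs => rw [show x = x 0 • e1 + x 1 • ![0, 1, 0] + x 2 • ![0, 0, 1] by
      ext i; fin_cases i <;> simp [e1]]
    rw [map_add, map_add, map_smul, map_smul, map_smul, h1]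
  have h01 : e1 1 = 0 := rfl
  have h02 : e1 2 = 0 := rfl
  have hl : |w 1| < w 2 := abs_lt_of_sq_lt_sq (by nlinarith) hw2.le
  rw [abs_lt] at hl
  refine ⟨w 2 + w 1, w 2 - w 1, by linarith, by linarith, fun x => ⟨hx0 x, ?_, ?_⟩⟩
  · rw [hsx]
    simp only [Pi.add_apply, Pi.smul_apply, smul_eq_mul, e1', e2', h01, h02]
    ring
  · rw [hsx]
    simp only [Pi.add_apply, Pi.smul_apply, smul_eq_mul, e1', e2', h01, h02]
    ring

/-! ### The model crooked half-spaces -/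

/-- The crooked half-space of direction `e1` and vertex `0`. -/
def modelHalf : Set E :=
  {x | (0 < x 1 + x 2 ∧ 0 < x 1 - x 2) ∨ (0 < x 1 + x 2 ∧ 0 < x 0) ∨ (0 < x 1 - x 2 ∧ x 0 < 0)}

/-- The crooked half-space of direction `-e1` and vertex `0`. -/
def modelOpp : Set E :=
  {x | (x 1 + x 2 < 0 ∧ x 1 - x 2 < 0) ∨ (x 1 - x 2 < 0 ∧ x 0 < 0) ∨ (x 1 + x 2 < 0 ∧ 0 < x 0)}

/-- All three sets depend only on the signs of `x 0`, `x 1 + x 2` and `x 1 - x 2`; the stem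
inequality says that the last two have nonpositive product. -/
lemma crookedPlane0_eq : crookedPlane0 = (modelHalf ∪ modelOpp)ᶜ := by
  ext x
  simp only [crookedPlane0, wingNeg0, stem0, wingPos0, modelHalf, modelOpp, Set.mem_union,
    Set.mem_ofPred_eq, Set.mem_compl_iff]
  constructor
  · rintro ((⟨h1, h2⟩ | ⟨h1, h2⟩) | ⟨h1, h2⟩) h
    · rcases h with (⟨h, h'⟩ | ⟨h, h'⟩ | ⟨h, h'⟩) | (⟨h, h'⟩ | ⟨h, h'⟩ | ⟨h, h'⟩) <;> linarith
    · rw [h1] at h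
      rcases abs_cases (x 1) with ⟨ha, _⟩ | ⟨ha, _⟩ <;>
      rcases abs_cases (x 2) with ⟨hb, _⟩ | ⟨hb, _⟩ <;> rw [ha, hb] at h2 <;>
      rcases h with (⟨h, h'⟩ | ⟨h, h'⟩ | ⟨h, h'⟩) | (⟨h, h'⟩ | ⟨h, h'⟩ | ⟨h, h'⟩) <;> linarith
    · rcases h with (⟨h, h'⟩ | ⟨h, h'⟩ | ⟨h, h'⟩) | (⟨h, h'⟩ | ⟨h, h'⟩ | ⟨h, h'⟩) <;> linarith
  · intro h
    push Not at h
    obtain ⟨⟨a1, a2, a3⟩, b1, b2, b3⟩ := h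
    rcases lt_trichotomy (x 0) 0 with h0 | h0 | h0
    · left; left
      have h1 : ¬ 0 < x 1 - x 2 := fun h => absurd (a3 h) (not_le.2 h0)
      have h2 : ¬ x 1 - x 2 < 0 := fun h => absurd (b2 h) (not_le.2 h0)
      exact ⟨h0.le, by
        rcases lt_trichotomy (x 1 - x 2) 0 with h | h | h
        · exact (h2 h).elim
        · linarith
        · exact (h1 h).elim⟩
    · left; right
      refine ⟨h0, sq_le_sq.1 ?_⟩
      by_contra hc
      push Not at hc
      have : 0 < (x 1 + x 2) * (x 1 - x 2) := by nlinarith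
      rcases mul_pos_iff.1 this with ⟨h, h'⟩ | ⟨h, h'⟩
      · linarith [a1 h]
      · linarith [b1 h]
    · right
      have h1 : ¬ 0 < x 1 + x 2 := fun h => absurd (a2 h) (not_le.2 h0)
      have h2 : ¬ x 1 + x 2 < 0 := fun h => absurd (b3 h) (not_le.2 h0)
      exact ⟨h0.le, by
        rcases lt_trichotomy (x 1 + x 2) 0 with h | h | h
        · exact (h2 h).elim
        · linarith
        · exact (h1 h).elim⟩

lemma isOpen_modelHalf : IsOpen modelHalf := by
  simp only [modelHalf, Set.ofPred_or, Set.ofPred_and]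
  refine IsOpen.union (IsOpen.inter ?_ ?_) (IsOpen.union (IsOpen.inter ?_ ?_) (IsOpen.inter ?_ ?_))
  all_goals exact isOpen_lt (by fun_prop) (by fun_prop)

lemma isOpen_modelOpp : IsOpen modelOpp := by
  simp only [modelOpp, Set.ofPred_or, Set.ofPred_and]
  refine IsOpen.union (IsOpen.inter ?_ ?_) (IsOpen.union (IsOpen.inter ?_ ?_) (IsOpen.inter ?_ ?_))
  all_goals exact isOpen_lt (by fun_prop) (by fun_prop)

lemma disjoint_model : Disjoint modelHalf modelOpp := by
  rw [Set.disjoint_left]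
  rintro x (⟨h, h'⟩ | ⟨h, h'⟩ | ⟨h, h'⟩) (⟨k, k'⟩ | ⟨k, k'⟩ | ⟨k, k'⟩) <;> linarith

/-- A union of three convex pieces, the first of which meets each of the others. -/
lemma isPreconnected_modelHalf : IsPreconnected modelHalf := by
  have c1 : Convex ℝ {x : E | 0 < x 1 + x 2 ∧ 0 < x 1 - x 2} := by
    intro x hx y hy a b ha hb hab
    obtain ⟨h1, h2⟩ := hx
    obtain ⟨h3, h4⟩ := hy
    rcases ha.eq_or_lt with rfl | ha
    · obtain rfl : b = 1 := by linarith
      rw [zero_smul, zero_add, one_smul]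
      exact ⟨h3, h4⟩
    · simp only [Set.mem_ofPred_eq, Pi.add_apply, Pi.smul_apply, smul_eq_mul]
      constructor <;> nlinarith [mul_pos ha h1, mul_pos ha h2, mul_nonneg hb h3.le,
        mul_nonneg hb h4.le]
  have c2 : Convex ℝ {x : E | 0 < x 1 + x 2 ∧ 0 < x 0} := by
    intro x hx y hy a b ha hb hab
    obtain ⟨h1, h2⟩ := hx
    obtain ⟨h3, h4⟩ := hy
    rcases ha.eq_or_lt with rfl | ha
    · obtain rfl : b = 1 := by linarith
      rw [zero_smul, zero_add, one_smul]
      exact ⟨h3, h4⟩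
    · simp only [Set.mem_ofPred_eq, Pi.add_apply, Pi.smul_apply, smul_eq_mul]
      constructor <;> nlinarith [mul_pos ha h1, mul_pos ha h2, mul_nonneg hb h3.le,
        mul_nonneg hb h4.le]
  have c3 : Convex ℝ {x : E | 0 < x 1 - x 2 ∧ x 0 < 0} := by
    intro x hx y hy a b ha hb hab
    obtain ⟨h1, h2⟩ := hx
    obtain ⟨h3, h4⟩ := hy
    rcases ha.eq_or_lt with rfl | ha
    · obtain rfl : b = 1 := by linarith
      rw [zero_smul, zero_add, one_smul]
      exact ⟨h3, h4⟩
    · simp only [Set.mem_ofPred_eq, Pi.add_apply, Pi.smul_apply, smul_eq_mul]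
      constructor <;> nlinarith [mul_pos ha h1, mul_pos ha (neg_pos.2 h2), mul_nonneg hb h3.le,
        mul_nonneg hb (neg_pos.2 h4).le]
  have h12 := IsPreconnected.union (![1, 1, 0] : E) (by simp) (by simp)
    c1.isPreconnected c2.isPreconnected
  have h123 := IsPreconnected.union (![-1, 1, 0] : E) (by simp) (by simp) h12 c3.isPreconnected
  convert h123 using 1
  ext x
  simp only [modelHalf, Set.mem_union, Set.mem_ofPred_eq, or_assoc]

lemma mem_modelOpp_iff (x : E) :
    x ∈ modelOpp ↔ rotation (-1) 0 (by norm_num) x ∈ modelHalf := by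
  simp only [modelOpp, modelHalf, rotation_apply, Set.mem_ofPred_eq]
  simp
  constructor <;> rintro (⟨h, h'⟩ | ⟨h, h'⟩ | ⟨h, h'⟩)
  · exact Or.inl ⟨by linarith, by linarith⟩
  · exact Or.inr (Or.inl ⟨by linarith, by linarith⟩)
  · exact Or.inr (Or.inr ⟨by linarith, by linarith⟩)
  · exact Or.inl ⟨by linarith, by linarith⟩
  · exact Or.inr (Or.inl ⟨by linarith, by linarith⟩)
  · exact Or.inr (Or.inr ⟨by linarith, by linarith⟩)

lemma closure_modelHalf : closure modelHalf = modelOppᶜ := by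
  refine Set.Subset.antisymm
    (closure_minimal disjoint_model.subset_compl_right isOpen_modelOpp.isClosed_compl) ?_
  intro x hx
  -- It is enough to find a direction that pushes `x` into the open half-space at once; which one
  -- works depends on which of the null coordinates is negative.
  have key : ∀ v : E, (∀ δ : ℝ, 0 < δ → x + δ • v ∈ modelHalf) → x ∈ closure modelHalf := by
    intro v hv
    have ht : Tendsto (fun δ : ℝ => x + δ • v) (𝓝[>] 0) (𝓝 x) := by
      have : Continuous fun δ : ℝ => x + δ • v := by fun_prop
      simpa using (this.tendsto 0).mono_left nhdsWithin_le_nhds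
    exact mem_closure_of_tendsto ht (eventually_mem_nhdsWithin.mono fun δ hδ => hv δ hδ)
  simp only [modelOpp, Set.mem_compl_iff, Set.mem_ofPred_eq] at hx
  push Not at hx
  obtain ⟨h1, h2, h3⟩ := hx
  by_cases hP : x 1 + x 2 < 0
  · refine key ![-1, 1, 0] fun δ hδ => Or.inr (Or.inr ?_)
    have := h1 hP
    have := h3 hP
    constructor <;> simp <;> linarith
  · by_cases hM : x 1 - x 2 < 0
    · refine key ![1, 1, 0] fun δ hδ => Or.inr (Or.inl ?_)
      have := h2 hM
      constructor <;> simp <;> linarith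
    · refine key ![0, 1, 0] fun δ hδ => Or.inl ?_
      constructor <;> simp <;> linarith

/-- The stabilizer of `e1` keeps `x 0` and rescales `x 1 + x 2` and `x 1 - x 2` by positive factors,
so it changes no sign. This is why a crooked half-space depends only on its direction and vertex. -/
lemma fix_e1_mem_modelHalf {s : E ≃ₗ[ℝ] E} (hs : s ∈ SO0) (h1 : s e1 = e1) (x : E) :
    s x ∈ modelHalf ↔ x ∈ modelHalf := by
  obtain ⟨l, m, hl, hm, h⟩ := SO0_fix_e1 hs h1
  obtain ⟨a, b, c⟩ := h x
  simp only [modelHalf, Set.mem_ofPred_eq, a, b, c, mul_pos_iff_of_pos_left hl,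
    mul_pos_iff_of_pos_left hm]

/-! ### Crooked half-spaces in a frame -/

/-- The crooked half-space of vertex `p` and direction `g e1`. -/
def halfSpace (g : E ≃ₗ[ℝ] E) (p : E) : Set E := {x | g⁻¹ (x - p) ∈ modelHalf}

/-- The crooked half-space of vertex `p` and direction `-g e1`. -/
def oppSpace (g : E ≃ₗ[ℝ] E) (p : E) : Set E := {x | g⁻¹ (x - p) ∈ modelOpp}

/-- The affine change of coordinates `y ↦ g y + p`. -/
noncomputable def frame (g : E ≃ₗ[ℝ] E) (p : E) : E ≃ₜ E :=
  g.toContinuousLinearEquiv.toHomeomorph.trans (Homeomorph.addRight p)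

lemma frame_apply (g : E ≃ₗ[ℝ] E) (p y : E) : frame g p y = g y + p := rfl

lemma frame_symm_apply (g : E ≃ₗ[ℝ] E) (p x : E) : (frame g p).symm x = g⁻¹ (x - p) := by
  rw [Homeomorph.symm_apply_eq, frame_apply, apply_inv_apply, sub_add_cancel]

lemma halfSpace_eq_preimage (g : E ≃ₗ[ℝ] E) (p : E) :
    halfSpace g p = (frame g p).symm ⁻¹' modelHalf := by
  ext x; rw [Set.mem_preimage, frame_symm_apply]; rfl

lemma oppSpace_eq_preimage (g : E ≃ₗ[ℝ] E) (p : E) :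
    oppSpace g p = (frame g p).symm ⁻¹' modelOpp := by
  ext x; rw [Set.mem_preimage, frame_symm_apply]; rfl

lemma isOpen_halfSpace (g : E ≃ₗ[ℝ] E) (p : E) : IsOpen (halfSpace g p) := by
  rw [halfSpace_eq_preimage]
  exact isOpen_modelHalf.preimage (Homeomorph.continuous _)

lemma isOpen_oppSpace (g : E ≃ₗ[ℝ] E) (p : E) : IsOpen (oppSpace g p) := by
  rw [oppSpace_eq_preimage]
  exact isOpen_modelOpp.preimage (Homeomorph.continuous _)

lemma disjoint_halfSpace_oppSpace (g : E ≃ₗ[ℝ] E) (p : E) :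
    Disjoint (halfSpace g p) (oppSpace g p) :=
  Set.disjoint_left.2 fun _ hx => Set.disjoint_left.1 disjoint_model hx

lemma closure_halfSpace (g : E ≃ₗ[ℝ] E) (p : E) : closure (halfSpace g p) = (oppSpace g p)ᶜ := by
  rw [halfSpace_eq_preimage, ← Homeomorph.preimage_closure, closure_modelHalf,
    oppSpace_eq_preimage, Set.preimage_compl]

lemma isPreconnected_halfSpace (g : E ≃ₗ[ℝ] E) (p : E) : IsPreconnected (halfSpace g p) := by
  rw [halfSpace_eq_preimage, ← Homeomorph.image_eq_preimage_symm]
  exact isPreconnected_modelHalf.image _ (Homeomorph.continuous _).continuousOn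

lemma halfSpace_congr {g g' : E ≃ₗ[ℝ] E} (hg : g ∈ SO0) (hg' : g' ∈ SO0) (h : g e1 = g' e1)
    (p : E) : halfSpace g p = halfSpace g' p := by
  ext x
  have hs : g'⁻¹ * g ∈ SO0 := mul_mem (inv_mem hg') hg
  have := fix_e1_mem_modelHalf hs (by rw [LinearEquiv.mul_apply, h, inv_apply_apply])
    (g⁻¹ (x - p))
  rw [LinearEquiv.mul_apply, apply_inv_apply] at this
  exact this.symm

/-- The half-turn exchanging the two sides of the model crooked plane. -/
def halfTurn : E ≃ₗ[ℝ] E := rotation (-1) 0 (by norm_num)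

lemma halfTurn_mem : halfTurn ∈ SO0 := rotation_mem _ _ _

lemma halfTurn_e1 : halfTurn e1 = -e1 := by
  ext i; fin_cases i <;> simp [halfTurn, rotation_apply, e1]

lemma halfTurn_halfTurn (x : E) : halfTurn (halfTurn x) = x := by
  ext i; fin_cases i <;> simp [halfTurn, rotation_apply]

lemma halfTurn_inv : halfTurn⁻¹ = halfTurn := by
  ext1 x
  rw [← inv_apply_apply halfTurn (halfTurn x), halfTurn_halfTurn]

lemma oppSpace_eq (g : E ≃ₗ[ℝ] E) (p : E) : oppSpace g p = halfSpace (g * halfTurn) p := by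
  ext x
  simp only [oppSpace, halfSpace, Set.mem_ofPred_eq, mul_inv_rev, halfTurn_inv,
    LinearEquiv.mul_apply]
  exact mem_modelOpp_iff _

lemma oppSpace_mul_halfTurn (g : E ≃ₗ[ℝ] E) (p : E) :
    oppSpace (g * halfTurn) p = halfSpace g p := by
  rw [oppSpace_eq, mul_assoc, show halfTurn * halfTurn = 1 from LinearEquiv.ext halfTurn_halfTurn,
    mul_one]

lemma closure_oppSpace (g : E ≃ₗ[ℝ] E) (p : E) : closure (oppSpace g p) = (halfSpace g p)ᶜ := by
  rw [oppSpace_eq, closure_halfSpace, oppSpace_mul_halfTurn]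

lemma mul_halfTurn_e1 (g : E ≃ₗ[ℝ] E) : (g * halfTurn) e1 = -g e1 := by
  rw [LinearEquiv.mul_apply, halfTurn_e1, map_neg]

lemma oppSpace_congr {g g' : E ≃ₗ[ℝ] E} (hg : g ∈ SO0) (hg' : g' ∈ SO0) (h : g e1 = g' e1)
    (p : E) : oppSpace g p = oppSpace g' p := by
  rw [oppSpace_eq, oppSpace_eq]
  exact halfSpace_congr (mul_mem hg halfTurn_mem) (mul_mem hg' halfTurn_mem)
    (by rw [mul_halfTurn_e1, mul_halfTurn_e1, h]) p

lemma crookedPlane_eq {g : E ≃ₗ[ℝ] E} (hg : g ∈ SO0) (p : E) :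
    crookedPlane (g e1) p = (halfSpace g p ∪ oppSpace g p)ᶜ := by
  ext x
  constructor
  · rintro ⟨g', hg', h, y, hy, rfl⟩
    rw [← halfSpace_congr hg' hg h, ← oppSpace_congr hg' hg h]
    rw [crookedPlane0_eq] at hy
    simpa [halfSpace, oppSpace, inv_apply_apply] using hy
  · intro hx
    refine ⟨g, hg, rfl, g⁻¹ (x - p), ?_, by rw [apply_inv_apply, add_sub_cancel]⟩
    rw [crookedPlane0_eq]
    simpa [halfSpace, oppSpace] using hx

lemma add_mem_halfSpace_of_mem_halfPlaneCone {g : E ≃ₗ[ℝ] E} (hg : g ∈ SO0) (p : E) {y : E}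
    (hy : y ∈ halfPlaneCone (g e1)) : p + y ∈ halfSpace g p := by
  obtain ⟨h1, h2⟩ := hy
  have hf := SO0_future (inv_mem hg) h1
  rw [← SO0_B_inv hg, B_e1] at h2
  have h3 := hf.1
  have h4 := hf.2
  simp only [B] at h3
  have : 0 < g⁻¹ y 1 + g⁻¹ y 2 := by
    have := abs_lt_of_sq_lt_sq (a := g⁻¹ y 1) (b := g⁻¹ y 2)
      (by nlinarith [mul_self_nonneg (g⁻¹ y 0)]) h4.le
    linarith [(abs_lt.1 this).1]
  rw [halfSpace, Set.mem_ofPred_eq, add_sub_cancel_left]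
  exact Or.inr (Or.inl ⟨this, h2⟩)

/-- The complement of the plane splits into two disjoint open sets, and the one containing the cone
is connected, hence is the whole component. -/
lemma crookedHalfSpace_eq {g : E ≃ₗ[ℝ] E} (hg : g ∈ SO0) (p : E) :
    crookedHalfSpace (g e1) p = halfSpace g p := by
  have hc : (crookedPlane (g e1) p)ᶜ = halfSpace g p ∪ oppSpace g p := by
    rw [crookedPlane_eq hg, compl_compl]
  have key : ∀ y ∈ halfPlaneCone (g e1),
      connectedComponentIn (crookedPlane (g e1) p)ᶜ (p + y) = halfSpace g p := by
    intro y hy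
    have hm := add_mem_halfSpace_of_mem_halfPlaneCone hg p hy
    rw [hc]
    refine Set.Subset.antisymm ?_ ((isPreconnected_halfSpace g p).subset_connectedComponentIn hm
      Set.subset_union_left)
    exact isPreconnected_connectedComponentIn.subset_left_of_subset_union (isOpen_halfSpace g p)
      (isOpen_oppSpace g p) (disjoint_halfSpace_oppSpace g p) (connectedComponentIn_subset _ _)
      ⟨p + y, mem_connectedComponentIn (Or.inl hm), hm⟩
  have hy0 : g ![1, 0, 2] ∈ halfPlaneCone (g e1) := by
    refine ⟨SO0_future hg ?_, ?_⟩
    · simp [future, B]; norm_num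
    · rw [SO0_B hg]; simp [B, e1]
  ext x
  constructor
  · rintro ⟨y, hy, hx⟩
    rwa [key y hy] at hx
  · intro hx
    exact ⟨_, hy0, by rwa [key _ hy0]⟩

/-! ### Rays and the uniqueness of the vertex and the direction -/

lemma eventually_pos_add_mul (a : ℝ) {b : ℝ} (hb : 0 < b) : ∀ᶠ r : ℝ in atTop, 0 < a + r * b :=
  (tendsto_atTop_add_const_left _ a (tendsto_id.atTop_mul_const hb)).eventually_gt_atTop 0

/-- Far along a timelike ray only the direction matters, not the vertex or the starting point. This
is how a crooked half-space remembers its hyperbolic half-plane. -/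
lemma eventually_mem_halfSpace {g : E ≃ₗ[ℝ] E} (hg : g ∈ SO0) (p c : E) {z : E} (hz : z ∈ future)
    (h : 0 < B z (g e1)) : ∀ᶠ r : ℝ in atTop, c + r • z ∈ halfSpace g p := by
  have hf := SO0_future (inv_mem hg) hz
  rw [← SO0_B_inv hg, B_e1] at h
  have h3 := hf.1
  have h4 := hf.2
  simp only [B] at h3
  have h5 : 0 < g⁻¹ z 1 + g⁻¹ z 2 := by
    have := abs_lt_of_sq_lt_sq (a := g⁻¹ z 1) (b := g⁻¹ z 2)
      (by nlinarith [mul_self_nonneg (g⁻¹ z 0)]) h4.le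
    linarith [(abs_lt.1 this).1]
  filter_upwards [eventually_pos_add_mul (g⁻¹ (c - p) 0) h,
    eventually_pos_add_mul (g⁻¹ (c - p) 1 + g⁻¹ (c - p) 2) h5] with r h1 h2
  have e : g⁻¹ (c + r • z - p) = g⁻¹ (c - p) + r • g⁻¹ z := by
    rw [← map_smul, ← map_add]; congr 1; abel
  rw [halfSpace, Set.mem_ofPred_eq, e]
  refine Or.inr (Or.inl ⟨?_, ?_⟩)
  · simp only [Pi.add_apply, Pi.smul_apply, smul_eq_mul]; linarith
  · simpa using h1

lemma eventually_mem_oppSpace {g : E ≃ₗ[ℝ] E} (hg : g ∈ SO0) (p c : E) {z : E} (hz : z ∈ future)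
    (h : B z (g e1) < 0) : ∀ᶠ r : ℝ in atTop, c + r • z ∈ oppSpace g p := by
  rw [oppSpace_eq]
  refine eventually_mem_halfSpace (mul_mem hg halfTurn_mem) p c hz ?_
  rw [mul_halfTurn_e1, B_neg_right]
  linarith

lemma eq_zero_of_abs_le_mul {a b : ℝ} (h : ∀ t : ℝ, 0 < t → t < 1 → |a| ≤ t * b) : a = 0 := by
  have ht : Tendsto (fun t : ℝ => t * b) (𝓝[>] 0) (𝓝 0) := by
    have : Continuous fun t : ℝ => t * b := by fun_prop
    simpa using (this.tendsto 0).mono_left nhdsWithin_le_nhds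
  have : |a| ≤ 0 := ge_of_tendsto ht <| by
    filter_upwards [Ioo_mem_nhdsGT (zero_lt_one' ℝ)] with t ht using h t ht.1 ht.2
  exact abs_nonpos_iff.1 this

/-- Future vectors with first coordinate `±t` straddle the plane of the stem; letting `t` tend to
`0` forces `v` to be orthogonal to that plane. -/
lemma eq_e1_of_sign {v : E} (hv : B v v = 1) (h1 : ∀ w ∈ future, 0 < w 0 → 0 ≤ B w v)
    (h2 : ∀ w ∈ future, w 0 < 0 → B w v ≤ 0) : v = e1 := by
  have a1 : v 2 = 0 := by
    refine eq_zero_of_abs_le_mul (b := v 0) fun t ht ht1 => abs_le.2 ?_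
    have := h1 ![t, 0, 1] ⟨by simp [B]; nlinarith, by simp⟩ (by simpa using ht)
    have := h2 ![-t, 0, 1] ⟨by simp [B]; nlinarith, by simp⟩ (by simpa using ht)
    simp [B] at *
    constructor <;> linarith
  have a2 : v 1 = 0 := by
    refine eq_zero_of_abs_le_mul (b := v 0) fun t ht ht1 => abs_le.2 ?_
    have := h1 ![t, 1, 2] ⟨by simp [B]; nlinarith, by simp⟩ (by simpa using ht)
    have := h2 ![-t, 1, 2] ⟨by simp [B]; nlinarith, by simp⟩ (by simpa using ht)
    simp [B, a1] at *
    constructor <;> linarith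
  have a0 : v 0 = 1 := by
    have := h1 ![1, 0, 2] ⟨by simp [B]; norm_num, by simp⟩ (by simp)
    simp [B, a1, a2] at this hv
    nlinarith
  ext i
  fin_cases i <;> simp [e1, a0, a1, a2]

/-- Where two of the three sign coordinates are fixed and large compared with `q`, membership
detects exactly the sign of the third, so translation by `q` cannot change that coordinate. -/
lemma eq_zero_of_sub_mem_modelHalf {q : E} (h : ∀ y, y ∈ modelHalf ↔ y - q ∈ modelHalf) :
    q = 0 := by
  have hP : ∀ x : E, 0 < x 0 → x 1 - x 2 < 0 → (x ∈ modelHalf ↔ 0 < x 1 + x 2) := by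
    intro x h0 hM
    refine ⟨?_, fun hP => Or.inr (Or.inl ⟨hP, h0⟩)⟩
    rintro (⟨a, b⟩ | ⟨a, b⟩ | ⟨a, b⟩) <;> linarith
  have hM : ∀ x : E, x 0 < 0 → x 1 + x 2 < 0 → (x ∈ modelHalf ↔ 0 < x 1 - x 2) := by
    intro x h0 hP
    refine ⟨?_, fun hM => Or.inr (Or.inr ⟨hM, h0⟩)⟩
    rintro (⟨a, b⟩ | ⟨a, b⟩ | ⟨a, b⟩) <;> linarith
  have h0 : ∀ x : E, 0 < x 1 + x 2 → x 1 - x 2 < 0 → (x ∈ modelHalf ↔ 0 < x 0) := by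
    intro x hP hM
    refine ⟨?_, fun h0 => Or.inr (Or.inl ⟨hP, h0⟩)⟩
    rintro (⟨a, b⟩ | ⟨a, b⟩ | ⟨a, b⟩) <;> linarith
  have same : ∀ c : ℝ, (∀ t : ℝ, 0 < t ↔ 0 < t - c) → c = 0 := by
    intro c hc
    rcases lt_trichotomy c 0 with hlt | heq | hgt
    · exact absurd ((hc 0).2 (by linarith)) (lt_irrefl 0)
    · exact heq
    · have := (hc c).1 hgt; linarith
  have e0 : q 0 = 0 := by
    refine same _ fun t => ?_
    have key := h ![t, 0, |q 1| + |q 2| + 1]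
    have b1 := abs_le.1 (le_refl |q 1|)
    have b2 := abs_le.1 (le_refl |q 2|)
    rw [h0, h0] at key <;> simp at key ⊢
    all_goals first | exact key | linarith
  have eP : q 1 + q 2 = 0 := by
    refine same _ fun t => ?_
    have b0 := abs_le.1 (le_refl |q 0|)
    have b1 := abs_le.1 (le_refl |q 1 - q 2|)
    have key := h ![|q 0| + 1, (t - (|q 1 - q 2| + 1)) / 2, (t + (|q 1 - q 2| + 1)) / 2]
    rw [hP, hP] at key
    · simp only [Matrix.cons_val, Pi.sub_apply] at key
      constructor
      · intro ht
        linarith [key.1 (by linarith)]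
      · intro ht
        linarith [key.2 (by linarith)]
    all_goals (simp; linarith)
  have eM : q 1 - q 2 = 0 := by
    refine same _ fun t => ?_
    have b0 := abs_le.1 (le_refl |q 0|)
    have b1 := abs_le.1 (le_refl |q 1 + q 2|)
    have key := h ![-(|q 0| + 1), (t - (|q 1 + q 2| + 1)) / 2, (-t - (|q 1 + q 2| + 1)) / 2]
    rw [hM, hM] at key
    · simp only [Matrix.cons_val, Pi.sub_apply] at key
      constructor
      · intro ht
        linarith [key.1 (by linarith)]
      · intro ht
        linarith [key.2 (by linarith)]
    all_goals (simp; linarith)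
  ext i
  fin_cases i
  · exact e0
  · simp; linarith
  · simp; linarith

/-- A crooked half-space determines its vertex and its direction. -/
lemma halfSpace_injective {g g' : E ≃ₗ[ℝ] E} (hg : g ∈ SO0) (hg' : g' ∈ SO0) {p p' : E}
    (h : halfSpace g p = halfSpace g' p') : p = p' ∧ g e1 = g' e1 := by
  have hO : oppSpace g p = oppSpace g' p' := by
    rw [← compl_inj_iff, ← closure_halfSpace, ← closure_halfSpace, h]
  have he : g e1 = g' e1 := by
    have : g⁻¹ (g' e1) = e1 := by
      refine eq_e1_of_sign ?_ (fun w hw hw0 => ?_) (fun w hw hw0 => ?_)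
      · rw [SO0_B (inv_mem hg), SO0_B hg']; simp [B, e1]
      · by_contra hc
        rw [B_comm, SO0_B_inv hg, B_comm] at hc
        have hz := SO0_future hg hw
        obtain ⟨r, h1, h2⟩ := ((eventually_mem_halfSpace hg p 0 hz
          (by rwa [SO0_B hg, B_e1])).and (eventually_mem_oppSpace hg' p' 0 hz (not_le.1 hc))).exists
        rw [← hO] at h2
        exact Set.disjoint_left.1 (disjoint_halfSpace_oppSpace g p) h1 h2
      · by_contra hc
        rw [B_comm, SO0_B_inv hg, B_comm] at hc
        have hz := SO0_future hg hw
        obtain ⟨r, h1, h2⟩ := ((eventually_mem_oppSpace hg p 0 hz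
          (by rwa [SO0_B hg, B_e1])).and (eventually_mem_halfSpace hg' p' 0 hz (not_le.1 hc))).exists
        rw [← h] at h2
        exact Set.disjoint_left.1 (disjoint_halfSpace_oppSpace g p) h2 h1
    rw [← apply_inv_apply g (g' e1), this]
  refine ⟨?_, he⟩
  rw [← halfSpace_congr hg hg' he] at h
  have hq : g⁻¹ (p - p') = 0 := by
    refine eq_zero_of_sub_mem_modelHalf fun y => ?_
    have := Set.ext_iff.1 h (g y + p')
    simp only [halfSpace, Set.mem_ofPred_eq, add_sub_cancel_right, inv_apply_apply] at this
    rw [← this, show g y + p' - p = g y - (p - p') by abel, map_sub, inv_apply_apply]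
  have := congrArg g hq
  rw [apply_inv_apply, map_zero] at this
  exact sub_eq_zero.1 this

/-! ### Disjoint half-spaces -/

/-- The half-planes of disjoint crooked half-spaces are disjoint. -/
lemma B_nonpos_of_disjoint {g g' : E ≃ₗ[ℝ] E} (hg : g ∈ SO0) (hg' : g' ∈ SO0) {p p' : E}
    (hd : Disjoint (halfSpace g p) (halfSpace g' p')) {z : E} (hz : B z z ≤ 0) (hz2 : 0 < z 2)
    (h : 0 ≤ B z (g e1)) : B z (g' e1) ≤ 0 := by
  by_contra hc
  push Not at hc
  -- Adding a small multiple of an interior vector `m` makes `z` timelike and strictly inside both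
  -- half-planes; a ray in that direction then enters both half-spaces.
  set m := g ![1, 0, 2] with hm
  have hmf : m ∈ future := SO0_future hg (by simp [future, B]; norm_num)
  have hmg : B m (g e1) = 1 := by rw [hm, SO0_B hg]; simp [B, e1]
  obtain ⟨δ, hδ, hδ'⟩ := exists_pos_mul_lt hc (-B m (g' e1))
  have hf : z + δ • m ∈ future := by
    constructor
    · have h1 := B_neg_of_future_of_causal hmf hz hz2
      have h2 := hmf.1
      have : B (z + δ • m) (z + δ • m) = B z z + 2 * δ * B m z + δ ^ 2 * B m m := by
        simp only [B, Pi.add_apply, Pi.smul_apply, smul_eq_mul]; ring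
      rw [this]
      nlinarith [mul_neg_of_pos_of_neg hδ h1, mul_neg_of_pos_of_neg (pow_pos hδ 2) h2]
    · have := hmf.2
      simp only [Pi.add_apply, Pi.smul_apply, smul_eq_mul]
      positivity
  obtain ⟨r, h1, h2⟩ := ((eventually_mem_halfSpace hg p 0 hf
    (by rw [B_add_left, B_smul_left, hmg]; linarith)).and
    (eventually_mem_halfSpace hg' p' 0 hf (by rw [B_add_left, B_smul_left]; linarith))).exists
  exact Set.disjoint_left.1 hd h1 h2

/-- Each open half-space misses the closure of the other, so a common point of the closures would
lie on both crooked planes. -/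
lemma disjoint_closure_halfSpace {g g' : E ≃ₗ[ℝ] E} (hg : g ∈ SO0) (hg' : g' ∈ SO0) {p p' : E}
    (hp : Disjoint (crookedPlane (g e1) p) (crookedPlane (g' e1) p'))
    (hd : Disjoint (halfSpace g p) (halfSpace g' p')) :
    Disjoint (closure (halfSpace g p)) (closure (halfSpace g' p')) := by
  have h1 : Disjoint (closure (halfSpace g p)) (halfSpace g' p') :=
    hd.closure_left (isOpen_halfSpace _ _)
  have h2 : Disjoint (halfSpace g p) (closure (halfSpace g' p')) :=
    hd.closure_right (isOpen_halfSpace _ _)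
  rw [Set.disjoint_left]
  intro x hx hx'
  have n1 : x ∉ halfSpace g' p' := fun h => Set.disjoint_left.1 h1 hx h
  have n2 : x ∉ halfSpace g p := fun h => Set.disjoint_left.1 h2 h hx'
  rw [closure_halfSpace] at hx hx'
  rw [crookedPlane_eq hg, crookedPlane_eq hg'] at hp
  have hp' := Set.disjoint_left.1 hp
  refine @hp' x ?_ ?_
  · rintro (h | h)
    · exact n2 h
    · exact hx h
  · rintro (h | h)
    · exact n1 h
    · exact hx' h

/-! ### Rulings of the crooked half-spaces by null planes and particles -/

/-- The determinant has the sign of `r = n 0 * y 1 - n 1 * y 0`, and up to the factor `n 2 ^ 2` the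
vector `y` is a multiple of `n` plus `r` times `(-n 1, n 0, 0)`. Each way of lying in `modelOpp`
then contradicts `r ≥ 0`. -/
lemma null_half_plane_model {n y q : E} (hn : B n n = 0) (hn2 : 0 < n 2) (hn0 : 0 ≤ n 0)
    (hy : B y n = 0) (hq : B q n < 0) (hd : 0 ≤ det3 y q n) : y ∉ modelOpp := by
  have hr : 0 ≤ n 0 * y 1 - n 1 * y 0 := by
    have : n 2 * det3 y q n = -B q n * (n 0 * y 1 - n 1 * y 0) := by
      simp only [det3, B] at *
      linear_combination (n 0 * q 1 - n 1 * q 0) * hy + (q 0 * y 1 - q 1 * y 0) * hn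
    nlinarith [mul_nonneg hn2.le hd]
  set r := n 0 * y 1 - n 1 * y 0 with hr_def
  simp only [B] at hn hy
  set Y := y 2 * n 2 with hY
  have e0 : n 2 ^ 2 * y 0 = n 0 * Y - n 1 * r := by
    rw [hr_def, hY]; linear_combination -y 0 * hn + n 0 * hy
  have e1' : n 2 ^ 2 * y 1 = n 1 * Y + n 0 * r := by
    rw [hr_def, hY]; linear_combination -y 1 * hn + n 1 * hy
  have e2 : n 2 ^ 2 * y 2 = n 2 * Y := by rw [hY]; ring
  have hn22 : 0 < n 2 ^ 2 := by positivity
  have hab := abs_le.1 (abs_le_of_sq_le_sq (a := n 1) (b := n 2)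
    (by nlinarith [mul_self_nonneg (n 0)]) hn2.le)
  have h0r : 0 ≤ n 0 * r := mul_nonneg hn0 hr
  rintro (⟨h, h'⟩ | ⟨h, h'⟩ | ⟨h, h'⟩)
  · have k := mul_neg_of_pos_of_neg hn22 h
    have k' := mul_neg_of_pos_of_neg hn22 h'
    rw [mul_add, e1', e2] at k
    rw [mul_sub, e1', e2] at k'
    rcases le_total 0 Y with hY0 | hY0
    · nlinarith [mul_nonneg hY0 (by linarith : 0 ≤ n 1 + n 2)]
    · nlinarith [mul_nonneg_of_nonpos_of_nonpos hY0 (by linarith : n 1 - n 2 ≤ 0)]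
  · have k := mul_neg_of_pos_of_neg hn22 h
    have k' := mul_neg_of_pos_of_neg hn22 h'
    rw [mul_sub, e1', e2] at k
    rw [e0] at k'
    have hYp : 0 < Y := by
      by_contra hc
      nlinarith [mul_nonneg_of_nonpos_of_nonpos (not_lt.1 hc) (by linarith : n 1 - n 2 ≤ 0)]
    have hn1 : 0 < n 1 := by
      by_contra hc
      nlinarith [mul_nonneg hn0 hYp.le, mul_nonneg_of_nonpos_of_nonpos (not_lt.1 hc)
        (neg_nonpos.2 hr)]
    -- Weighting the two inequalities by `n 1` and `n 0` eliminates `r` and leaves `n 2 * (n 2 - n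
    -- 1) * Y < 0`. The third case is symmetric.
    have a1 := mul_pos_of_neg_of_neg k (neg_neg_of_pos hn1)
    have a2 := mul_nonneg hn0 (neg_nonneg.2 k'.le)
    have a3 : 0 ≤ (n 2 - n 1) * Y * n 2 :=
      mul_nonneg (mul_nonneg (by linarith) hYp.le) hn2.le
    have : n 0 * n 0 * Y = (n 2 * n 2 - n 1 * n 1) * Y := by
      linear_combination Y * hn
    nlinarith
  · have k := mul_neg_of_pos_of_neg hn22 h
    have k' := mul_pos hn22 h'
    rw [mul_add, e1', e2] at k
    rw [e0] at k'
    have hYn : Y < 0 := by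
      by_contra hc
      nlinarith [mul_nonneg (not_lt.1 hc) (by linarith : 0 ≤ n 1 + n 2)]
    have hn1 : n 1 < 0 := by
      by_contra hc
      nlinarith [mul_nonneg hn0 (neg_nonneg.2 hYn.le), mul_nonneg (not_lt.1 hc) hr]
    have a1 := mul_pos_of_neg_of_neg k hn1
    have a2 := mul_nonneg hn0 k'.le
    have a3 : 0 ≤ (n 2 + n 1) * (-Y) * n 2 :=
      mul_nonneg (mul_nonneg (by linarith) (by linarith)) hn2.le
    have : n 0 * n 0 * Y = (n 2 * n 2 - n 1 * n 1) * Y := by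
      linear_combination Y * hn
    nlinarith

/-- The closed crooked half-space of vertex `p` contains, for every null direction `n` in the
closure of its half-plane, one of the two closed half-planes bounded by the line `p + ℝ n` in the
null plane `p + n^⊥`. -/
lemma add_mem_closure_halfSpace {g : E ≃ₗ[ℝ] E} (hg : g ∈ SO0) (p : E) {n y q : E}
    (hn : B n n = 0) (hn2 : 0 < n 2) (hn0 : 0 ≤ B n (g e1))
    (hy : B y n = 0) (hq : B q n < 0) (hd : 0 ≤ det3 y q n) : p + y ∈ closure (halfSpace g p) := by
  have hg' := inv_mem hg
  rw [closure_halfSpace]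
  show ¬ (g⁻¹ (p + y - p) ∈ modelOpp)
  rw [add_sub_cancel_left]
  refine null_half_plane_model (n := g⁻¹ n) (q := g⁻¹ q) ?_ ?_ ?_ ?_ ?_ ?_
  · rwa [SO0_B hg']
  · exact SO0_pos hg' hn.le hn2
  · rwa [← B_e1 (g⁻¹ n), SO0_B_inv hg]
  · rwa [SO0_B hg']
  · rwa [SO0_B hg']
  · rwa [SO0_det3 hg']

/-- A point of a crooked half-space, seen from a future-pointing vector outside of its half-plane,
is moved towards one of the endpoints of the half-plane. -/
lemma exists_null_det3_nonneg {g : E ≃ₗ[ℝ] E} (hg : g ∈ SO0) {p x q : E} (hx : x ∈ halfSpace g p)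
    (hq : q ∈ future) (hq0 : B q (g e1) ≤ 0) :
    ∃ n, B n n = 0 ∧ 0 < n 2 ∧ B n (g e1) = 0 ∧ 0 ≤ det3 (x - p) q n := by
  have hg' := inv_mem hg
  set y := g⁻¹ (x - p) with hy
  set w := g⁻¹ q with hw
  have hwf : w ∈ future := SO0_future hg' hq
  have hw0 : w 0 ≤ 0 := by rwa [← B_e1 w, SO0_B_inv hg]
  have h3 := hwf.1
  simp only [B] at h3
  have hab := abs_lt.1 (abs_lt_of_sq_lt_sq (a := w 1) (b := w 2)
    (by nlinarith [mul_self_nonneg (w 0)]) hwf.2.le)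
  have key : ∃ n : E, B n n = 0 ∧ 0 < n 2 ∧ n 0 = 0 ∧ 0 ≤ det3 y w n := by
    have hp : 0 ≤ y 0 → 0 ≤ y 1 + y 2 →
        ∃ n : E, B n n = 0 ∧ 0 < n 2 ∧ n 0 = 0 ∧ 0 ≤ det3 y w n := by
      intro h1 h2
      refine ⟨![0, -1, 1], by simp [B], by simp, by simp, ?_⟩
      simp [det3]
      nlinarith [mul_nonneg h1 (by linarith : 0 ≤ w 1 + w 2), mul_nonneg (neg_nonneg.2 hw0) h2]
    have hm : y 0 ≤ 0 → 0 ≤ y 1 - y 2 →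
        ∃ n : E, B n n = 0 ∧ 0 < n 2 ∧ n 0 = 0 ∧ 0 ≤ det3 y w n := by
      intro h1 h2
      refine ⟨![0, 1, 1], by simp [B], by simp, by simp, ?_⟩
      simp [det3]
      nlinarith [mul_nonneg (neg_nonneg.2 h1) (by linarith : 0 ≤ w 2 - w 1),
        mul_nonneg (neg_nonneg.2 hw0) h2]
    rcases (hx : y ∈ modelHalf) with ⟨h1, h2⟩ | ⟨h1, h2⟩ | ⟨h1, h2⟩
    · rcases le_total 0 (y 0) with h | h
      · exact hp h h1.le
      · exact hm h h2.le
    · exact hp h2.le h1.le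
    · exact hm h2.le h1.le
  obtain ⟨n, h1, h2, h4, h5⟩ := key
  refine ⟨g n, by rwa [SO0_B hg], SO0_pos hg h1.le h2, by rwa [SO0_B hg, B_e1], ?_⟩
  rw [← SO0_det3 hg, hy, hw, apply_inv_apply, apply_inv_apply] at h5
  exact h5

/-! ### Null vectors as squares of spinors -/

/-- The null vector which is the square of the spinor `(a, b)`. -/
def nullSq (a b : ℝ) : E := ![2 * a * b, a ^ 2 - b ^ 2, a ^ 2 + b ^ 2]

/-- The symmetric product of two spinors. -/
def spinorProd (a b a' b' : ℝ) : E := ![a * b' + b * a', a * a' - b * b', a * a' + b * b']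

lemma B_nullSq_self (a b : ℝ) : B (nullSq a b) (nullSq a b) = 0 := by
  simp [B, nullSq]; ring

lemma B_nullSq (a b a' b' : ℝ) :
    B (nullSq a b) (nullSq a' b') = -2 * (a * b' - b * a') ^ 2 := by
  simp [B, nullSq]; ring

/-- The determinant vanishes to first order in `a * b' - b * a'`, whereas `B_nullSq` vanishes to
second order. The cofactor `B t (spinorProd a b a' b')` stays meaningful when the two null
directions coincide. -/
lemma det3_nullSq (t : E) (a b a' b' : ℝ) :
    det3 t (nullSq a b) (nullSq a' b') =
      2 * ((a * b' - b * a') * B t (spinorProd a b a' b')) := by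
  simp [B, det3, nullSq, spinorProd]; ring

/-- The half-angle formulas; `y = -1` is separate because `a` vanishes there. -/
lemma exists_unit_spinor {x y : ℝ} (h : x ^ 2 + y ^ 2 = 1) :
    ∃ a b : ℝ, a ^ 2 + b ^ 2 = 1 ∧ 2 * a * b = x ∧ a ^ 2 - b ^ 2 = y := by
  by_cases hy : y = -1
  · have : x = 0 := by rw [hy] at h; nlinarith
    exact ⟨0, 1, by norm_num, by simp [this], by simp [hy]⟩
  · have hy' : 0 < 1 + y := by
      rcases lt_or_ge (-1) y with h' | h'
      · linarith
      · exact absurd (le_antisymm h' (by nlinarith [sq_nonneg x])) hy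
    set a := √((1 + y) / 2) with ha
    have ha0 : 0 < a := Real.sqrt_pos.2 (by linarith)
    have ha2 : a ^ 2 = (1 + y) / 2 := Real.sq_sqrt (by linarith)
    have hb2 : (x / (2 * a)) ^ 2 = (1 - y) / 2 := by
      rw [div_pow, mul_pow, ha2, div_eq_iff (by positivity)]
      linear_combination h
    refine ⟨a, x / (2 * a), ?_, by field_simp, ?_⟩ <;> rw [ha2, hb2] <;> ring

lemma exists_nullSq_eq {n : E} (hn : B n n = 0) (hn2 : 0 < n 2) :
    ∃ a b : ℝ, a ^ 2 + b ^ 2 = 1 ∧ n = n 2 • nullSq a b := by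
  simp only [B] at hn
  obtain ⟨a, b, h1, h2, h3⟩ := exists_unit_spinor (x := n 0 / n 2) (y := n 1 / n 2)
    (by field_simp; linarith)
  refine ⟨a, b, h1, ?_⟩
  ext i
  fin_cases i
  · simp [nullSq, h2]; field_simp
  · simp [nullSq, h3]; field_simp
  · simp [nullSq, h1]

lemma vertex_mem_closure_halfSpace (g : E ≃ₗ[ℝ] E) (p : E) : p ∈ closure (halfSpace g p) := by
  rw [closure_halfSpace]
  show ¬ (g⁻¹ (p - p) ∈ modelOpp)
  simp [modelOpp]

/-! ### The contraction between two disjoint crooked planes -/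

/-- If `w ≠ 0` and `w * G ≤ 0`, the null half-plane at `p` along `n` meets the null line through
`p'` along `n'`. If `w = 0`, the null directions agree, and `G = 0` would put both vertices in one
null plane, where one of them lies in the half-plane of the other. -/
lemma B_spinorProd_ne_zero {g g' : E ≃ₗ[ℝ] E} (hg : g ∈ SO0) (hg' : g' ∈ SO0) {p p' : E}
    (hd : Disjoint (closure (halfSpace g p)) (closure (halfSpace g' p')))
    {a b a' b' : ℝ} (h : a ^ 2 + b ^ 2 = 1) (h' : a' ^ 2 + b' ^ 2 = 1)
    (hn : 0 ≤ B (nullSq a b) (g e1)) (hn' : 0 ≤ B (nullSq a' b') (g' e1)) :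
    0 ≤ (a * b' - b * a') * B (p' - p) (spinorProd a b a' b') ∧
      B (p' - p) (spinorProd a b a' b') ≠ 0 := by
  set w := a * b' - b * a' with hw
  set G := B (p' - p) (spinorProd a b a' b') with hG
  have h2 : 0 < nullSq a b 2 := by simp [nullSq, h]
  have h2' : 0 < nullSq a' b' 2 := by simp [nullSq, h']
  by_cases hw0 : w = 0
  · refine ⟨by simp [hw0], fun hG0 => ?_⟩
    have ha : a' = (a * a' + b * b') * a := by linear_combination -a' * h - b * (hw.symm.trans hw0)
    have hb : b' = (a * a' + b * b') * b := by linear_combination -b' * h + a * (hw.symm.trans hw0)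
    set l := a * a' + b * b' with hl
    have hS : spinorProd a b a' b' = l • nullSq a b := by
      ext i
      fin_cases i
      · simp [spinorProd, nullSq]; linear_combination a * hb + b * ha
      · simp [spinorProd, nullSq]; linear_combination a * ha - b * hb
      · simp [spinorProd, nullSq]; linear_combination a * ha + b * hb
    have hl0 : l ≠ 0 := fun h0 => by rw [ha, hb, h0] at h'; norm_num at h'
    have hn'' : 0 ≤ B (nullSq a b) (g' e1) := by
      have : nullSq a' b' = l ^ 2 • nullSq a b := by
        rw [ha, hb]
        ext i; fin_cases i <;> simp [nullSq] <;> ring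
      rw [this, B_smul_left] at hn'
      exact nonneg_of_mul_nonneg_right hn' (by positivity)
    rw [hG, hS, B_smul_right] at hG0
    have ht : B (p' - p) (nullSq a b) = 0 := (mul_eq_zero.1 hG0).resolve_left hl0
    have hq : B ![0, 0, 1] (nullSq a b) < 0 :=
      B_neg_of_future_of_causal e3_mem_future (B_nullSq_self a b).le h2
    rcases le_total 0 (det3 (p' - p) ![0, 0, 1] (nullSq a b)) with hdet | hdet
    · have := add_mem_closure_halfSpace hg p (B_nullSq_self a b) h2 hn ht hq hdet
      rw [add_sub_cancel] at this
      exact Set.disjoint_left.1 hd this (vertex_mem_closure_halfSpace g' p')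
    · have := add_mem_closure_halfSpace hg' p' (y := p - p') (B_nullSq_self a b) h2 hn''
        (by rw [← neg_sub, B_neg_left, ht, neg_zero]) hq
        (by simp only [det3, Pi.sub_apply] at hdet ⊢; linarith)
      rw [add_sub_cancel] at this
      exact Set.disjoint_left.1 hd (vertex_mem_closure_halfSpace g p) this
  · suffices hpos : 0 < w * G from ⟨hpos.le, fun h0 => by simp [h0] at hpos⟩
    by_contra hc
    push Not at hc
    have hq : B (nullSq a' b') (nullSq a b) < 0 := by
      rw [B_comm, B_nullSq]
      have : 0 < w ^ 2 := by positivity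
      linarith
    -- `c`, `c'` and `G / w ^ 2` are the coordinates of `p' - p` in the basis formed by the two null
    -- vectors and the spinor product, which is orthogonal to both.
    set c := -B (p' - p) (nullSq a' b') / (2 * w ^ 2) with hcdef
    set c' := -B (p' - p) (nullSq a b) / (2 * w ^ 2) with hcdef'
    have hSn : B (spinorProd a b a' b') (nullSq a b) = 0 := by
      simp [B, spinorProd, nullSq]; ring
    have m1 := add_mem_closure_halfSpace hg p (q := nullSq a' b')
      (y := c • nullSq a b + (G / w ^ 2) • spinorProd a b a' b')
      (B_nullSq_self a b) h2 hn
      (by rw [B_add_left, B_smul_left, B_smul_left, B_nullSq_self, hSn]; simp) hq (by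
        have e : det3 (c • nullSq a b + (G / w ^ 2) • spinorProd a b a' b') (nullSq a' b')
            (nullSq a b) = (G / w ^ 2) * (-2 * w ^ 3) := by
          simp [det3, nullSq, spinorProd, hw]; ring
        rw [e, show G / w ^ 2 * (-2 * w ^ 3) = -2 * (w * G) by field_simp]
        linarith)
    have m2 := add_mem_closure_halfSpace hg' p' (q := nullSq a b) (y := (-c') • nullSq a' b')
      (B_nullSq_self a' b') h2' hn'
      (by rw [B_smul_left, B_nullSq_self, mul_zero]) (by rwa [B_comm]) (by
        apply le_of_eq
        simp [det3]; ring)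
    have e : p + (c • nullSq a b + (G / w ^ 2) • spinorProd a b a' b') =
        p' + (-c') • nullSq a' b' := by
      have key : (2 * w ^ 2) • (p' - p) = (-B (p' - p) (nullSq a' b')) • nullSq a b +
          (-B (p' - p) (nullSq a b)) • nullSq a' b' + (2 * G) • spinorProd a b a' b' := by
        rw [hG, hw]
        ext i
        fin_cases i <;> simp [B, nullSq, spinorProd] <;> ring
      have h0 : (2 * w ^ 2) ≠ 0 := by positivity
      have : p' - p = c • nullSq a b + c' • nullSq a' b' + (G / w ^ 2) • spinorProd a b a' b' := by
        rw [← inv_smul_smul₀ h0 (p' - p), key, smul_add, smul_add, smul_smul, smul_smul, smul_smul,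
          ← div_eq_inv_mul, ← div_eq_inv_mul, ← div_eq_inv_mul, mul_div_mul_left _ _ two_ne_zero]
      rw [← sub_eq_zero] at this ⊢
      rw [← neg_eq_zero, ← this, neg_smul]
      abel
    rw [e] at m1
    exact Set.disjoint_left.1 hd m1 m2

/-- A geodesic going from the half-plane of a crooked half-space to the half-plane of a disjoint
one is contracted, at a uniform rate, by the difference of the vertices. -/
lemma exists_contraction {g g' : E ≃ₗ[ℝ] E} (hg : g ∈ SO0) (hg' : g' ∈ SO0) {p p' : E}
    (hd : Disjoint (closure (halfSpace g p)) (closure (halfSpace g' p'))) :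
    ∃ ε : ℝ, 0 < ε ∧ ∀ n n' : E, B n n = 0 → 0 < n 2 → B n' n' = 0 → 0 < n' 2 →
      0 ≤ B n (g e1) → 0 ≤ B n' (g' e1) → ε * -B n n' ≤ det3 (p' - p) n n' := by
  -- Unit spinors representing the allowed pairs of ends, coinciding ends included. A spinor is
  -- determined by its square only up to sign, so the quantity to minimize is an absolute value.
  set S : Set (ℝ × ℝ × ℝ × ℝ) := {s | s.1 ^ 2 + s.2.1 ^ 2 = 1 ∧ s.2.2.1 ^ 2 + s.2.2.2 ^ 2 = 1 ∧
    0 ≤ B (nullSq s.1 s.2.1) (g e1) ∧ 0 ≤ B (nullSq s.2.2.1 s.2.2.2) (g' e1)} with hS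
  have hcont : Continuous fun s : ℝ × ℝ × ℝ × ℝ =>
      |B (p' - p) (spinorProd s.1 s.2.1 s.2.2.1 s.2.2.2)| := by
    simp only [B, spinorProd, Matrix.cons_val]
    fun_prop
  have hclosed : IsClosed S := by
    simp only [hS, B, nullSq, Matrix.cons_val, Set.ofPred_and]
    refine IsClosed.inter ?_ (IsClosed.inter ?_ (IsClosed.inter ?_ ?_))
    · exact isClosed_eq (by fun_prop) (by fun_prop)
    · exact isClosed_eq (by fun_prop) (by fun_prop)
    · exact isClosed_le (by fun_prop) (by fun_prop)
    · exact isClosed_le (by fun_prop) (by fun_prop)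
  have hcomp : IsCompact S := by
    refine IsCompact.of_isClosed_subset
      (isCompact_Icc (a := ((-1, -1, -1, -1) : ℝ × ℝ × ℝ × ℝ)) (b := (1, 1, 1, 1))) hclosed ?_
    rintro ⟨a, b, a', b'⟩ ⟨h1, h2, -, -⟩
    simp only at h1 h2
    refine ⟨⟨?_, ?_, ?_, ?_⟩, ⟨?_, ?_, ?_, ?_⟩⟩ <;> simp only <;> nlinarith
  obtain ⟨ε, hε, hmin⟩ : ∃ ε : ℝ, 0 < ε ∧ ∀ s ∈ S,
      ε ≤ |B (p' - p) (spinorProd s.1 s.2.1 s.2.2.1 s.2.2.2)| := by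
    rcases S.eq_empty_or_nonempty with h0 | h0
    · exact ⟨1, one_pos, by simp [h0]⟩
    · obtain ⟨s, hs, hmin⟩ := hcomp.exists_isMinOn h0 hcont.continuousOn
      exact ⟨_, abs_pos.2 (B_spinorProd_ne_zero hg hg' hd hs.1 hs.2.1 hs.2.2.1 hs.2.2.2).2,
        fun r hr => hmin hr⟩
  refine ⟨ε, hε, fun n n' hn hn2 hn' hn2' hu hu' => ?_⟩
  obtain ⟨a, b, h, hab⟩ := exists_nullSq_eq hn hn2
  obtain ⟨a', b', h', hab'⟩ := exists_nullSq_eq hn' hn2'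
  rw [hab, B_smul_left] at hu
  rw [hab', B_smul_left] at hu'
  replace hu := nonneg_of_mul_nonneg_right hu hn2
  replace hu' := nonneg_of_mul_nonneg_right hu' hn2'
  have h1 := (B_spinorProd_ne_zero hg hg' hd h h' hu hu').1
  have h2 := hmin (a, b, a', b') ⟨h, h', hu, hu'⟩
  simp only at h2
  have hdet : det3 (p' - p) n n' = n 2 * n' 2 * det3 (p' - p) (nullSq a b) (nullSq a' b') := by
    conv_lhs => rw [hab, hab']
    simp only [det3, Pi.smul_apply, smul_eq_mul]
    ring
  have hB : B n n' = n 2 * n' 2 * B (nullSq a b) (nullSq a' b') := by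
    conv_lhs => rw [hab, hab']
    rw [B_smul_left, B_smul_right, mul_assoc]
  rw [hdet, hB, B_nullSq, det3_nullSq]
  set w := a * b' - b * a'
  have hw : |w| ≤ 1 := by
    refine abs_le_one_iff_mul_self_le_one.2 ?_
    nlinarith [sq_nonneg (a * a' + b * b')]
  -- Since `|w| ≤ 1`, the first-order bound `ε * |w|` dominates `ε * w ^ 2`.
  have h3 : ε * w ^ 2 ≤ w * B (p' - p) (spinorProd a b a' b') := by
    rw [← abs_of_nonneg h1, abs_mul, ← sq_abs]
    nlinarith [mul_le_mul_of_nonneg_left h2 (abs_nonneg w), abs_nonneg w,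
      mul_nonneg hε.le (mul_nonneg (abs_nonneg w) (sub_nonneg.2 hw))]
  nlinarith [mul_le_mul_of_nonneg_left h3 (mul_pos hn2 hn2').le]

/-! ### Crooked Schottky groups -/

lemma B_nonpos_of_causal {a b : E} (ha : B a a ≤ 0) (ha2 : 0 < a 2) (hb : B b b ≤ 0)
    (hb2 : 0 < b 2) : B a b ≤ 0 := by
  simp only [B] at *
  have : |a 0 * b 0 + a 1 * b 1| ≤ a 2 * b 2 := by
    refine abs_le_of_sq_le_sq ?_ (by positivity)
    have h1 : (a 0 * b 0 + a 1 * b 1) ^ 2 ≤ (a 0 ^ 2 + a 1 ^ 2) * (b 0 ^ 2 + b 1 ^ 2) := by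
      nlinarith [sq_nonneg (a 0 * b 1 - a 1 * b 0)]
    have h2 : (a 0 ^ 2 + a 1 ^ 2) * (b 0 ^ 2 + b 1 ^ 2) ≤ a 2 ^ 2 * b 2 ^ 2 := by
      gcongr <;> nlinarith
    linarith [mul_pow (a 2) (b 2) 2]
  linarith [le_abs_self (a 0 * b 0 + a 1 * b 1)]

lemma linear_sub (h : E ≃ᵃ[ℝ] E) (x p : E) : h.linear (x - p) = h x - h p :=
  (h : E →ᵃ[ℝ] E).linearMap_vsub x p

/-- Affine automorphisms transport framed crooked half-spaces. -/
lemma image_halfSpace (h : E ≃ᵃ[ℝ] E) (g : E ≃ₗ[ℝ] E) (p : E) :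
    h '' halfSpace g p = halfSpace (h.linear * g) (h p) := by
  have key : ∀ x, (h.linear * g)⁻¹ (h x - h p) = g⁻¹ (x - p) := fun x => by
    have : h x - h p = h.linear (x - p) := (linear_sub h x p).symm
    rw [this, mul_inv_rev, LinearEquiv.mul_apply, inv_apply_apply]
  ext y
  constructor
  · rintro ⟨x, hx, rfl⟩
    show (h.linear * g)⁻¹ (h x - h p) ∈ modelHalf
    rw [key]
    exact hx
  · intro hy
    obtain ⟨x, rfl⟩ := h.surjective y
    refine ⟨x, ?_, rfl⟩
    show g⁻¹ (x - p) ∈ modelHalf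
    rw [← key]
    exact hy

/-- Pairwise disjoint crooked half-spaces with pairwise disjoint closures, given in frames, and
affine isometries pairing them. -/
structure SchottkyData (m : ℕ) where
  /-- The frames. -/
  g : Fin m × Bool → E ≃ₗ[ℝ] E
  /-- The vertices. -/
  p : Fin m × Bool → E
  /-- The generators. -/
  h : Fin m → E ≃ᵃ[ℝ] E
  g_mem : ∀ k, g k ∈ SO0
  h_mem : ∀ i, (h i).linear ∈ SO0
  disj : ∀ k l, k ≠ l →
    Disjoint (closure (halfSpace (g k) (p k))) (closure (halfSpace (g l) (p l)))
  pair : ∀ i, h i '' halfSpace (g (i, false)) (p (i, false)) =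
    oppSpace (g (i, true)) (p (i, true))

namespace SchottkyData

variable {m : ℕ} (S : SchottkyData m)

/-- The crooked half-spaces. -/
def H (k : Fin m × Bool) : Set E := halfSpace (S.g k) (S.p k)

/-- The complements of the closed crooked half-spaces. -/
def O (k : Fin m × Bool) : Set E := oppSpace (S.g k) (S.p k)

/-- The directions. -/
def u (k : Fin m × Bool) : E := S.g k e1

/-- The index of the half-space paired with a given one. -/
def bar (k : Fin m × Bool) : Fin m × Bool := (k.1, !k.2)

/-- The generator or inverse generator mapping into the half-space of index `k`. -/
noncomputable def c (k : Fin m × Bool) : E ≃ᵃ[ℝ] E := bif k.2 then S.h k.1 else (S.h k.1)⁻¹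

/-- The group generated by the pairings. -/
def Γ : Subgroup (E ≃ᵃ[ℝ] E) := Subgroup.closure (Set.range S.h)

/-- The open crooked polyhedron. -/
def X : Set E := (⋃ k, closure (S.H k))ᶜ

/-- The closed crooked polyhedron. -/
def Y : Set E := (⋃ k, S.H k)ᶜ

lemma bar_bar (k : Fin m × Bool) : bar (bar k) = k := by simp [bar]

lemma c_bar (k : Fin m × Bool) : S.c (bar k) = (S.c k)⁻¹ := by
  rcases k with ⟨i, _ | _⟩ <;> simp [c, bar]

lemma c_mem (k : Fin m × Bool) : S.c k ∈ S.Γ := by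
  have h : ∀ i, S.h i ∈ S.Γ := fun i => Subgroup.subset_closure ⟨i, rfl⟩
  rcases k with ⟨i, _ | _⟩
  · exact inv_mem (h i)
  · exact h i

lemma c_linear_mem (k : Fin m × Bool) : (S.c k).linear ∈ SO0 := by
  rcases k with ⟨i, _ | _⟩
  · exact inv_mem (S.h_mem i)
  · exact S.h_mem i

lemma inv_apply_self (γ : E ≃ᵃ[ℝ] E) (x : E) : γ⁻¹ (γ x) = x := γ.symm_apply_apply x
lemma apply_inv_self (γ : E ≃ᵃ[ℝ] E) (x : E) : γ (γ⁻¹ x) = x := γ.apply_symm_apply x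

lemma mem_image_iff (γ : E ≃ᵃ[ℝ] E) (A : Set E) (x : E) : x ∈ γ '' A ↔ γ⁻¹ x ∈ A := by
  constructor
  · rintro ⟨y, hy, rfl⟩
    rwa [inv_apply_self]
  · exact fun h => ⟨_, h, apply_inv_self γ x⟩

/-- The pairing is only an equality of sets; rigidity of crooked half-spaces turns it into an
equality of vertices and directions, which the telescoping of vertex differences requires. -/
lemma h_vertex_direction (i : Fin m) :
    S.h i (S.p (i, false)) = S.p (i, true) ∧ (S.h i).linear (S.u (i, false)) = -S.u (i, true) := by
  have h := S.pair i
  rw [image_halfSpace, oppSpace_eq] at h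
  have := halfSpace_injective (mul_mem (S.h_mem i) (S.g_mem _))
    (mul_mem (S.g_mem _) halfTurn_mem) h
  rwa [mul_halfTurn_e1, LinearEquiv.mul_apply] at this

lemma c_vertex (k : Fin m × Bool) : S.c k (S.p (bar k)) = S.p k := by
  rcases k with ⟨i, _ | _⟩
  · show (S.h i)⁻¹ (S.p (i, true)) = _
    rw [← (S.h_vertex_direction i).1, inv_apply_self]
  · exact (S.h_vertex_direction i).1

lemma c_direction (k : Fin m × Bool) : (S.c k).linear (S.u (bar k)) = -S.u k := by
  rcases k with ⟨i, _ | _⟩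
  · have h := (S.h_vertex_direction i).2
    show (S.h i).linear⁻¹ (S.u (i, true)) = _
    rw [← neg_neg (S.u (i, true)), ← h, map_neg, inv_apply_apply]
  · exact (S.h_vertex_direction i).2

lemma image_O_bar (k : Fin m × Bool) : S.c k '' S.O (bar k) = S.H k := by
  rw [O, H, oppSpace_eq, image_halfSpace, c_vertex]
  refine halfSpace_congr (mul_mem (S.c_linear_mem k) (mul_mem (S.g_mem _) halfTurn_mem))
    (S.g_mem _) ?_ _
  rw [LinearEquiv.mul_apply, mul_halfTurn_e1, map_neg]
  exact neg_eq_iff_eq_neg.2 (S.c_direction k)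

lemma mem_H_iff (k : Fin m × Bool) (x : E) : x ∈ S.H k ↔ (S.c k)⁻¹ x ∈ S.O (bar k) := by
  rw [← S.image_O_bar, mem_image_iff]

lemma closure_H (k : Fin m × Bool) : closure (S.H k) = (S.O k)ᶜ := closure_halfSpace _ _

lemma closure_O (k : Fin m × Bool) : closure (S.O k) = (S.H k)ᶜ := closure_oppSpace _ _

lemma isOpen_H (k : Fin m × Bool) : IsOpen (S.H k) := isOpen_halfSpace _ _

lemma disjoint_H {k l : Fin m × Bool} (h : k ≠ l) : Disjoint (S.H k) (S.H l) :=
  (S.disj k l h).mono subset_closure subset_closure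

lemma H_subset_O {k l : Fin m × Bool} (h : k ≠ l) : S.H k ⊆ S.O l := by
  intro x hx
  by_contra hc
  have : x ∈ closure (S.H l) := by rwa [S.closure_H]
  exact Set.disjoint_left.1 (S.disj k l h) (subset_closure hx) this

lemma disjoint_H_O (k : Fin m × Bool) : Disjoint (S.H k) (S.O k) := disjoint_halfSpace_oppSpace _ _

lemma B_u_nonpos {k l : Fin m × Bool} (h : k ≠ l) {z : E} (hz : B z z ≤ 0) (hz2 : 0 < z 2)
    (hk : 0 ≤ B z (S.u k)) : B z (S.u l) ≤ 0 :=
  B_nonpos_of_disjoint (S.g_mem k) (S.g_mem l) (S.disjoint_H h) hz hz2 hk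

lemma exists_uniform_contraction : ∃ ε : ℝ, 0 < ε ∧ ∀ k l, k ≠ l → ∀ n n' : E, B n n = 0 →
    0 < n 2 → B n' n' = 0 → 0 < n' 2 → 0 ≤ B n (S.u k) → 0 ≤ B n' (S.u l) →
    ε * -B n n' ≤ det3 (S.p l - S.p k) n n' := by
  have : ∀ kl : (Fin m × Bool) × (Fin m × Bool), ∃ ε : ℝ, 0 < ε ∧ (kl.1 ≠ kl.2 → ∀ n n' : E,
      B n n = 0 → 0 < n 2 → B n' n' = 0 → 0 < n' 2 → 0 ≤ B n (S.u kl.1) → 0 ≤ B n' (S.u kl.2) →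
      ε * -B n n' ≤ det3 (S.p kl.2 - S.p kl.1) n n') := by
    rintro ⟨k, l⟩
    by_cases h : k = l
    · exact ⟨1, one_pos, fun h' => absurd h h'⟩
    · obtain ⟨ε, h1, h2⟩ := exists_contraction (S.g_mem k) (S.g_mem l) (S.disj k l h)
      exact ⟨ε, h1, fun _ => h2⟩
  choose ε hε hc using this
  rcases isEmpty_or_nonempty (Fin m × Bool) with he | he
  · exact ⟨1, one_pos, fun k => (he.false k).elim⟩
  · obtain ⟨kl, hmin⟩ := Finite.exists_min ε
    refine ⟨ε kl, hε kl, fun k l hkl n n' hn hn2 hn' hn2' hu hu' => ?_⟩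
    refine le_trans ?_ (hc (k, l) hkl n n' hn hn2 hn' hn2' hu hu')
    have h1 : B n n' ≤ 0 := B_nonpos_of_causal hn.le hn2 hn'.le hn2'
    exact mul_le_mul_of_nonneg_right (hmin _) (by linarith)

/-! ### The translates of the closed polyhedron cover -/

/-- If `x` lies in no translate of the closed polyhedron, some geodesic through `q`, with endpoints
`n` and `n'`, is contracted by `x - S.p k` at an arbitrarily large rate. -/
lemma exists_large_contraction {ε : ℝ}
    (hε : ∀ k l, k ≠ l → ∀ n n' : E, B n n = 0 →
      0 < n 2 → B n' n' = 0 → 0 < n' 2 → 0 ≤ B n (S.u k) → 0 ≤ B n' (S.u l) →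
      ε * -B n n' ≤ det3 (S.p l - S.p k) n n') (N : ℕ) :
    ∀ (x : E) (k : Fin m × Bool) (q : E), (∀ γ ∈ S.Γ, γ x ∉ S.Y) → x ∈ S.H k → q ∈ future →
      B q (S.u k) ≤ 0 → ∃ n n' : E, B n n = 0 ∧ 0 < n 2 ∧ B n' n' = 0 ∧ 0 < n' 2 ∧ n + n' = q ∧
        0 ≤ B n' (S.u k) ∧ N * (ε * -(B q q / 2)) ≤ det3 (x - S.p k) n n' := by
  induction N with
  | zero =>
    intro x k q _ hx hq hqk
    obtain ⟨ν, h1, h2, h3, h4⟩ := exists_null_det3_nonneg (S.g_mem k) hx hq hqk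
    have hqν := B_neg_of_future_of_causal hq h1.le h2
    have hqq := hq.1
    -- With this `s` the vector `q - s • ν` is null: it is the other end of the geodesic that runs
    -- through `q` to `ν`.
    set s := B q q / (2 * B q ν) with hs
    have hs0 : 0 < s := div_pos_of_neg_of_neg hqq (by linarith)
    have hsν : s * B q ν = B q q / 2 := by
      rw [hs, div_mul_eq_mul_div, div_eq_div_iff (by linarith) two_ne_zero]
      ring
    have hnn : B (q - s • ν) (q - s • ν) = 0 := by
      rw [B_sub_left, B_sub_right, B_sub_right, B_smul_left, B_smul_right, B_smul_left, B_smul_right,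
        h1, B_comm ν q, hsν]
      ring
    refine ⟨q - s • ν, s • ν, hnn, ?_, ?_, ?_, sub_add_cancel _ _, ?_, ?_⟩
    · refine pos_of_B_neg hq hnn.le ?_
      rw [B_sub_right, B_smul_right, hsν]
      linarith
    · rw [B_smul_left, B_smul_right, h1]; simp
    · simp only [Pi.smul_apply, smul_eq_mul]; positivity
    · rw [B_smul_left, u, h3, mul_zero]
    · have : det3 (x - S.p k) (q - s • ν) (s • ν) = s * det3 (x - S.p k) q ν := by
        simp only [det3, Pi.sub_apply, Pi.smul_apply, smul_eq_mul]; ring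
      rw [this, Nat.cast_zero, zero_mul]
      positivity
  | succ N ih =>
    intro x k q hbad hx hq hqk
    set α := S.c (bar k) with hα
    have hL := S.c_linear_mem (bar k)
    rw [← hα] at hL
    have hαp : α (S.p k) = S.p (bar k) := by
      have := S.c_vertex (bar k)
      rwa [bar_bar] at this
    have hαu : α.linear (S.u k) = -S.u (bar k) := by
      have := S.c_direction (bar k)
      rwa [bar_bar] at this
    have hαx : α x ∈ S.O (bar k) := by
      rw [hα, c_bar, ← S.mem_H_iff]
      exact hx
    have hbad' : ∀ γ ∈ S.Γ, γ (α x) ∉ S.Y := fun γ hγ =>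
      hbad (γ * α) (mul_mem hγ (S.c_mem _))
    obtain ⟨l, hl⟩ : ∃ l, α x ∈ S.H l := by
      have : α x ∉ S.Y := hbad' 1 (one_mem _)
      simpa only [Y, Set.mem_compl_iff, not_not, Set.mem_iUnion] using this
    have hlk : bar k ≠ l := by
      rintro rfl
      exact Set.disjoint_left.1 (S.disjoint_H_O _) hl hαx
    have hq' : α.linear q ∈ future := SO0_future hL hq
    have hqb : 0 ≤ B (α.linear q) (S.u (bar k)) := by
      rw [← neg_neg (S.u (bar k)), ← hαu, B_neg_right, SO0_B hL]
      linarith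
    obtain ⟨n, n', h1, h2, h3, h4, h5, h6, h7⟩ := ih (α x) l (α.linear q) hbad' hl hq'
      (S.B_u_nonpos hlk hq'.1.le hq'.2 hqb)
    have h8 : B n' (S.u (bar k)) ≤ 0 := S.B_u_nonpos hlk.symm h3.le h4 h6
    -- The end `n'` lies on the nonpositive side of `bar k` but the sum `n + n'` does not lie
    -- strictly there, so `n` is in the closed half-plane of `bar k`: the geodesic runs from that
    -- half-plane to the one of `l`.
    have h9 : 0 ≤ B n (S.u (bar k)) := by
      rw [← h5, B_add_left] at hqb
      linarith
    have h10 := hε (bar k) l hlk n n' h1 h2 h3 h4 h9 h6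
    have hnn' : B n n' = B q q / 2 := by
      rw [← SO0_B hL q q, ← h5, B_add_left, B_add_right, B_add_right, h1, h3, B_comm n' n]
      ring
    have hLi := inv_mem hL
    refine ⟨α.linear⁻¹ n, α.linear⁻¹ n', ?_, ?_, ?_, ?_, ?_, ?_, ?_⟩
    · rwa [SO0_B hLi]
    · exact SO0_pos hLi h1.le h2
    · rwa [SO0_B hLi]
    · exact SO0_pos hLi h3.le h4
    · rw [← map_add, h5, inv_apply_apply]
    · rw [SO0_B_inv hL, hαu, B_neg_right]
      linarith
    · have hx' : α.linear (x - S.p k) = (α x - S.p l) + (S.p l - S.p (bar k)) := by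
        rw [sub_add_sub_cancel, ← hαp]
        exact linear_sub α x (S.p k)
      rw [← SO0_det3 hL, apply_inv_apply, apply_inv_apply, hx', det3_add_left]
      rw [SO0_B hL] at h7
      rw [hnn'] at h10
      push_cast
      linarith

lemma abs_le_of_causal {n : E} (hn : B n n ≤ 0) (hn2 : 0 < n 2) : |n 0| ≤ n 2 ∧ |n 1| ≤ n 2 := by
  simp only [B] at hn
  exact ⟨abs_le_of_sq_le_sq (by nlinarith [mul_self_nonneg (n 1)]) hn2.le,
    abs_le_of_sq_le_sq (by nlinarith [mul_self_nonneg (n 0)]) hn2.le⟩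

/-- Replacing `n` by `q = n + n'` leaves the determinant unchanged, and all entries of `q` and `n'`
are at most `q 2` in absolute value. -/
lemma det3_le {y n n' q : E} (hn2 : 0 < n 2) (hn' : B n' n' ≤ 0)
    (hn2' : 0 < n' 2) (hq : q ∈ future) (h : n + n' = q) :
    det3 y n n' ≤ (|y 0| + |y 1| + |y 2|) * (2 * q 2 ^ 2) := by
  have e : det3 y n n' = det3 y q n' := by
    rw [← h]; simp only [det3, Pi.add_apply]; ring
  have hle : n' 2 ≤ q 2 := by rw [← h]; simp only [Pi.add_apply]; linarith
  obtain ⟨a0, a1⟩ := abs_le_of_causal hn' hn2'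
  obtain ⟨b0, b1⟩ := abs_le_of_causal hq.1.le hq.2
  have hq2 := hq.2
  have a2 : |n' 2| ≤ q 2 := by rwa [abs_of_pos hn2']
  have b2 : |q 2| ≤ q 2 := by rw [abs_of_pos hq2]
  have key : ∀ z a b c d : ℝ, |a| ≤ q 2 → |b| ≤ q 2 → |c| ≤ q 2 → |d| ≤ q 2 →
      z * (a * b - c * d) ≤ |z| * (2 * q 2 ^ 2) := by
    intro z a b c d ha hb hc hd
    refine (le_abs_self _).trans ?_
    rw [abs_mul]
    refine mul_le_mul_of_nonneg_left ?_ (abs_nonneg z)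
    refine (abs_sub _ _).trans ?_
    rw [abs_mul, abs_mul]
    nlinarith [mul_le_mul ha hb (abs_nonneg b) hq2.le, mul_le_mul hc hd (abs_nonneg d) hq2.le]
  rw [e, det3]
  have := key (y 0) (q 1) (n' 2) (q 2) (n' 1) b1 a2 b2 (a1.trans hle)
  have := key (y 1) (q 2) (n' 0) (q 0) (n' 2) b2 (a0.trans hle) b0 a2
  have := key (y 2) (q 0) (n' 1) (q 1) (n' 0) b0 (a1.trans hle) b1 (a0.trans hle)
  linarith

/-- Every point lies in a translate of the closed crooked polyhedron. -/
lemma exists_apply_mem_Y (x : E) : ∃ γ ∈ S.Γ, γ x ∈ S.Y := by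
  by_contra hbad
  push Not at hbad
  obtain ⟨k, hk⟩ : ∃ k, x ∈ S.H k := by
    have : x ∉ S.Y := hbad 1 (one_mem _)
    simpa only [Y, Set.mem_compl_iff, not_not, Set.mem_iUnion] using this
  set q := S.g k ![-1, 0, 2] with hqdef
  have hq : q ∈ future := SO0_future (S.g_mem k) (by simp [future, B]; norm_num)
  have hqk : B q (S.u k) ≤ 0 := by
    rw [u, SO0_B (S.g_mem k)]; simp [B, e1]
  obtain ⟨ε, hε, hcon⟩ := S.exists_uniform_contraction
  have hpos : 0 < ε * -(B q q / 2) := mul_pos hε (by linarith [hq.1])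
  obtain ⟨N, hN⟩ := exists_nat_gt
    ((|(x - S.p k) 0| + |(x - S.p k) 1| + |(x - S.p k) 2|) * (2 * q 2 ^ 2) / (ε * -(B q q / 2)))
  obtain ⟨n, n', h1, h2, h3, h4, h5, -, h7⟩ :=
    S.exists_large_contraction hcon N x k q hbad hk hq hqk
  rw [div_lt_iff₀ hpos] at hN
  linarith [det3_le (y := x - S.p k) h2 h3.le h4 hq h5]

/-! ### The tiling by the translates of the crooked polyhedron -/

lemma mem_X_iff (x : E) : x ∈ S.X ↔ ∀ k, x ∈ S.O k := by
  simp only [X, closure_H, Set.mem_compl_iff, Set.mem_iUnion, not_exists, not_not]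

lemma mem_Y_iff (x : E) : x ∈ S.Y ↔ ∀ k, x ∉ S.H k := by
  simp only [Y, Set.mem_compl_iff, Set.mem_iUnion, not_exists]

lemma isOpen_X : IsOpen S.X :=
  (isClosed_iUnion_of_finite fun _ => isClosed_closure).isOpen_compl

/-- The complement of the closed half-spaces other than the one of index `k`. -/
def others (k : Fin m × Bool) : Set E := ⋂ l ∈ {l | l ≠ k}, S.O l

lemma mem_others_iff (k : Fin m × Bool) (x : E) : x ∈ S.others k ↔ ∀ l, l ≠ k → x ∈ S.O l := by
  simp [others]

lemma isOpen_others (k : Fin m × Bool) : IsOpen (S.others k) :=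
  (Set.toFinite _).isOpen_biInter fun _ _ => isOpen_oppSpace _ _

lemma mem_others_of_not_mem_O {k : Fin m × Bool} {x : E} (h : x ∉ S.O k) : x ∈ S.others k := by
  rw [mem_others_iff]
  intro l hl
  by_contra hc
  have h1 : x ∈ closure (S.H k) := by rwa [S.closure_H]
  have h2 : x ∈ closure (S.H l) := by rwa [S.closure_H]
  exact Set.disjoint_left.1 (S.disj l k hl) h2 h1

lemma closure_X : closure S.X = S.Y := by
  refine Set.Subset.antisymm (closure_minimal (fun x hx => ?_)
    (isOpen_iUnion S.isOpen_H).isClosed_compl) fun x hx => ?_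
  · rw [mem_X_iff] at hx
    rw [mem_Y_iff]
    exact fun k hk => Set.disjoint_left.1 (S.disjoint_H_O k) hk (hx k)
  · by_cases h : ∃ k, x ∉ S.O k
    · obtain ⟨k, hk⟩ := h
      have h1 : x ∈ closure (S.O k) := by
        rw [S.closure_O]
        exact (S.mem_Y_iff x).1 hx k
      have h2 := S.mem_others_of_not_mem_O hk
      refine closure_mono ?_ ((S.isOpen_others k).inter_closure ⟨h2, h1⟩)
      rintro y ⟨hy1, hy2⟩
      rw [mem_others_iff] at hy1
      rw [mem_X_iff]
      intro l
      by_cases hl : l = k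
      · rwa [hl]
      · exact hy1 l hl
    · push Not at h
      exact subset_closure ((S.mem_X_iff x).2 h)

lemma Y_nonempty : S.Y.Nonempty := by
  rcases isEmpty_or_nonempty (Fin m × Bool) with he | ⟨⟨k⟩⟩
  · exact ⟨0, (S.mem_Y_iff 0).2 fun k => (he.false k).elim⟩
  · refine ⟨S.p k, (S.mem_Y_iff _).2 fun l hl => ?_⟩
    by_cases h : k = l
    · subst h
      have : (S.g k)⁻¹ (S.p k - S.p k) ∈ modelHalf := hl
      simp [modelHalf] at this
    · exact Set.disjoint_left.1 (S.disj k l h) (vertex_mem_closure_halfSpace _ _)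
        (subset_closure hl)

lemma X_nonempty : S.X.Nonempty := by
  rw [← closure_nonempty_iff, closure_X]
  exact S.Y_nonempty

lemma X_subset_Y : S.X ⊆ S.Y := by
  rw [← closure_X]
  exact subset_closure

/-! ### Ping-pong, freeness and disjointness of the open tiles -/

lemma apply_mem_H {k : Fin m × Bool} {x : E} (h : x ∈ S.O (bar k)) : S.c k x ∈ S.H k := by
  rwa [S.mem_H_iff, inv_apply_self]

/-- Ping-pong: a nonempty reduced word maps the polyhedron into the half-space of its first
letter. -/
lemma reducedWord_apply_mem {x : E} (hx : x ∈ S.X) (L : List (Fin m × Bool)) :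
    ∀ k, FreeGroup.IsReduced (k :: L) → ((k :: L).map S.c).prod x ∈ S.H k := by
  rw [mem_X_iff] at hx
  induction L with
  | nil =>
    intro k _
    simpa using S.apply_mem_H (hx _)
  | cons l L ih =>
    intro k hk
    have h2 := ih l (List.IsChain.tail hk)
    have hkl : k.1 = l.1 → k.2 = l.2 := by
      rw [FreeGroup.IsReduced, List.isChain_cons_cons] at hk
      exact hk.1
    have hne : l ≠ bar k := by
      rintro rfl
      have := hkl rfl
      simp [bar] at this
    rw [List.map_cons, List.prod_cons]
    exact S.apply_mem_H (S.H_subset_O hne h2)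

lemma lift_apply_not_mem_Y {w : FreeGroup (Fin m)} (hw : w ≠ 1) {x : E} (hx : x ∈ S.X) :
    FreeGroup.lift S.h w x ∉ S.Y := by
  have hred : FreeGroup.IsReduced w.toWord := FreeGroup.isReduced_toWord
  have hne : w.toWord ≠ [] := by rwa [ne_eq, FreeGroup.toWord_eq_nil_iff]
  have hlift : FreeGroup.lift S.h w = (w.toWord.map S.c).prod := by
    conv_lhs => rw [← FreeGroup.mk_toWord (x := w)]
    rw [FreeGroup.lift_mk]
    rfl
  obtain ⟨k, L, hL⟩ := List.exists_cons_of_ne_nil hne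
  rw [hlift, hL, mem_Y_iff]
  rw [hL] at hred
  exact fun h => h k (S.reducedWord_apply_mem hx L k hred)

lemma lift_injective : Function.Injective (FreeGroup.lift S.h) := by
  rw [injective_iff_map_eq_one]
  intro w hw
  by_contra hc
  obtain ⟨x, hx⟩ := S.X_nonempty
  have := S.lift_apply_not_mem_Y hc hx
  rw [hw] at this
  exact this (S.X_subset_Y hx)

/-- Only the source point has to be in the open polyhedron. Allowing the target in `Y` lets a tile
be identified even from a point on a wall. -/
lemma eq_one_of_apply_mem {γ : E ≃ᵃ[ℝ] E} (hγ : γ ∈ S.Γ) {x : E} (hx : x ∈ S.X)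
    (h : γ x ∈ S.Y) : γ = 1 := by
  rw [Γ, ← FreeGroup.range_lift_eq_closure] at hγ
  obtain ⟨w, rfl⟩ := hγ
  by_contra hc
  exact S.lift_apply_not_mem_Y (fun hw => hc (by rw [hw, map_one])) hx h

lemma disjoint_image_X {γ γ' : E ≃ᵃ[ℝ] E} (hγ : γ ∈ S.Γ) (hγ' : γ' ∈ S.Γ) (hne : γ ≠ γ') :
    Disjoint (γ '' S.X) (γ' '' S.X) := by
  rw [Set.disjoint_left]
  rintro _ ⟨x, hx, rfl⟩ hy
  rw [mem_image_iff] at hy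
  have : γ'⁻¹ * γ = 1 := S.eq_one_of_apply_mem (mul_mem (inv_mem hγ') hγ) hx (S.X_subset_Y hy)
  exact hne (inv_mul_eq_one.1 this).symm

/-! ### Local finiteness of the tiling and proper discontinuity -/

lemma continuous_affineEquiv (γ : E ≃ᵃ[ℝ] E) : Continuous γ :=
  AffineEquiv.continuous_of_finiteDimensional γ

/-- An open set meeting a closed tile meets the open tile. -/
lemma exists_mem_X_of_image_Y_inter {γ : E ≃ᵃ[ℝ] E} {V : Set E} (hV : IsOpen V)
    (h : ((γ '' S.Y) ∩ V).Nonempty) : ∃ x ∈ S.X, γ x ∈ V := by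
  obtain ⟨_, ⟨y, hy, rfl⟩, hyV⟩ := h
  rw [← closure_X, mem_closure_iff] at hy
  obtain ⟨x, hx1, hx2⟩ := hy _ (hV.preimage (continuous_affineEquiv γ)) hyV
  exact ⟨x, hx2, hx1⟩

/-- A point of the closed polyhedron has a neighbourhood meeting at most two tiles. -/
lemma exists_nhds_of_mem_Y {x : E} (hx : x ∈ S.Y) : ∃ V : Set E, IsOpen V ∧ x ∈ V ∧
    {γ : E ≃ᵃ[ℝ] E | γ ∈ S.Γ ∧ ((γ '' S.Y) ∩ V).Nonempty}.Finite := by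
  by_cases h : ∃ k, x ∉ S.O k
  · obtain ⟨k, hk⟩ := h
    -- A wall point lies on exactly one wall `k`. The neighbourhood avoids all other walls of `Y`
    -- and, on the far side, all other walls of the adjacent tile `c k '' Y`, so only these two
    -- tiles can meet it.
    refine ⟨S.others k ∩ (fun y => (S.c k)⁻¹ y) ⁻¹' S.others (bar k),
      (S.isOpen_others k).inter ((S.isOpen_others _).preimage (continuous_affineEquiv _)),
      ⟨S.mem_others_of_not_mem_O hk, S.mem_others_of_not_mem_O ?_⟩,
      (Set.toFinite {1, S.c k}).subset ?_⟩
    · rw [← S.mem_H_iff]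
      exact (S.mem_Y_iff x).1 hx k
    · rintro γ ⟨hγ, hne⟩
      obtain ⟨y, hy, hy1, hy2⟩ := S.exists_mem_X_of_image_Y_inter
        ((S.isOpen_others k).inter ((S.isOpen_others _).preimage (continuous_affineEquiv _))) hne
      rw [mem_others_iff] at hy1
      by_cases hyk : γ y ∈ S.H k
      · right
        have h1 : (S.c k)⁻¹ (γ y) ∈ S.X := by
          rw [mem_X_iff]
          intro l
          by_cases hl : l = bar k
          · rw [hl]
            exact (S.mem_H_iff k _).1 hyk
          · exact (S.mem_others_iff _ _).1 hy2 l hl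
        have := S.eq_one_of_apply_mem (γ := (S.c k)⁻¹ * γ) (mul_mem (inv_mem (S.c_mem k)) hγ) hy
          (S.X_subset_Y h1)
        exact (inv_mul_eq_one.1 this).symm
      · left
        refine S.eq_one_of_apply_mem hγ hy ((S.mem_Y_iff _).2 fun l hl => ?_)
        by_cases hlk : l = k
        · exact hyk (hlk ▸ hl)
        · exact Set.disjoint_left.1 (S.disjoint_H_O l) hl (hy1 l hlk)
  · push Not at h
    refine ⟨S.X, S.isOpen_X, (S.mem_X_iff x).2 h, (Set.finite_singleton 1).subset ?_⟩
    rintro γ ⟨hγ, hne⟩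
    obtain ⟨y, hy, hy'⟩ := S.exists_mem_X_of_image_Y_inter S.isOpen_X hne
    exact S.eq_one_of_apply_mem hγ hy (S.X_subset_Y hy')

lemma exists_nhds (x : E) : ∃ V : Set E, IsOpen V ∧ x ∈ V ∧
    {γ : E ≃ᵃ[ℝ] E | γ ∈ S.Γ ∧ ((γ '' S.Y) ∩ V).Nonempty}.Finite := by
  obtain ⟨β, hβ, hx⟩ := S.exists_apply_mem_Y x
  obtain ⟨V, hV, hxV, hfin⟩ := S.exists_nhds_of_mem_Y hx
  refine ⟨β ⁻¹' V, hV.preimage (continuous_affineEquiv β), hxV,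
    (hfin.image fun γ => β⁻¹ * γ).subset ?_⟩
  rintro γ ⟨hγ, _, ⟨y, hy, rfl⟩, hyV⟩
  exact ⟨β * γ, ⟨mul_mem hβ hγ, β (γ y), ⟨y, hy, rfl⟩, hyV⟩, inv_mul_cancel_left _ _⟩

lemma finite_image_Y_inter {K : Set E} (hK : IsCompact K) :
    {γ : E ≃ᵃ[ℝ] E | γ ∈ S.Γ ∧ ((γ '' S.Y) ∩ K).Nonempty}.Finite := by
  refine hK.induction_on (p := fun K =>
    {γ : E ≃ᵃ[ℝ] E | γ ∈ S.Γ ∧ ((γ '' S.Y) ∩ K).Nonempty}.Finite) ?_ ?_ ?_ ?_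
  · simp
  · intro s t hst ht
    exact ht.subset fun γ hγ => ⟨hγ.1, hγ.2.mono (Set.inter_subset_inter_right _ hst)⟩
  · intro s t hs ht
    refine (hs.union ht).subset ?_
    rintro γ ⟨hγ, y, hy, hy' | hy'⟩
    · exact Or.inl ⟨hγ, y, hy, hy'⟩
    · exact Or.inr ⟨hγ, y, hy, hy'⟩
  · intro x _
    obtain ⟨V, hV, hxV, hfin⟩ := S.exists_nhds x
    exact ⟨V, mem_nhdsWithin_of_mem_nhds (hV.mem_nhds hxV), hfin⟩

lemma actsProperlyDiscontinuously : ActsProperlyDiscontinuously S.Γ := by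
  intro K L hK hL
  refine (Set.Finite.image2 (fun b a => b * a⁻¹) (S.finite_image_Y_inter hL)
    (S.finite_image_Y_inter hK)).subset ?_
  rintro γ ⟨hγ, _, ⟨x, hxK, rfl⟩, hxL⟩
  obtain ⟨β, hβ, hx⟩ := S.exists_apply_mem_Y x
  -- If `x` lies in the tile of `β⁻¹`, then `γ x` lies in that of `γ * β⁻¹`. Thus `γ` is a quotient
  -- of two elements, one whose tile meets `L` and one whose tile meets `K`.
  refine ⟨γ * β⁻¹, ⟨mul_mem hγ (inv_mem hβ), γ x, ⟨β x, hx, ?_⟩, hxL⟩, β⁻¹,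
    ⟨inv_mem hβ, x, ⟨β x, hx, inv_apply_self β x⟩, hxK⟩, by simp⟩
  exact congrArg γ (inv_apply_self β x)

lemma isFundamentalDomain : IsFundamentalDomain S.Γ S.X where
  isOpen := S.isOpen_X
  disjoint _ hγ _ hγ' hne := S.disjoint_image_X hγ hγ' hne
  covers := by
    refine Set.eq_univ_of_forall fun x => ?_
    obtain ⟨β, hβ, hx⟩ := S.exists_apply_mem_Y x
    rw [closure_X]
    exact Set.mem_biUnion (inv_mem hβ) ⟨β x, hx, inv_apply_self β x⟩
  locallyFinite K hK := by
    rw [closure_X]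
    exact S.finite_image_Y_inter hK

end SchottkyData

end Crooked

/-- The index `(i, true)` stands for `(i, +)` and `(i, false)` for `(i, -)`. -/
theorem mainTheorem1 (m : ℕ)
    (u p : Fin m × Bool → Crooked.E)
    (hu : ∀ k, u k ∈ Crooked.unitSpacelike)
    (h : Fin m → (Crooked.E ≃ᵃ[ℝ] Crooked.E))
    (hh : ∀ i, h i ∈ Crooked.Isom0)
    (hplane : ∀ k l, k ≠ l →
      Disjoint (Crooked.crookedPlane (u k) (p k)) (Crooked.crookedPlane (u l) (p l)))
    (hhalf : ∀ k l, k ≠ l →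
      Disjoint (Crooked.crookedHalfSpace (u k) (p k)) (Crooked.crookedHalfSpace (u l) (p l)))
    (hpair : ∀ i, h i '' Crooked.crookedHalfSpace (u (i, false)) (p (i, false)) =
      (closure (Crooked.crookedHalfSpace (u (i, true)) (p (i, true))))ᶜ) :
    Crooked.ActsProperlyDiscontinuously (Subgroup.closure (Set.range h)) ∧
    Crooked.IsFundamentalDomain (Subgroup.closure (Set.range h))
      (⋃ i : Fin m, (closure (Crooked.crookedHalfSpace (u (i, true)) (p (i, true))) ∪
        closure (Crooked.crookedHalfSpace (u (i, false)) (p (i, false)))))ᶜ ∧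
    Function.Injective (FreeGroup.lift h) := by
  choose g hg hgu using fun k => Crooked.exists_SO0_e1 (hu k)
  have hH : ∀ k, Crooked.crookedHalfSpace (u k) (p k) = Crooked.halfSpace (g k) (p k) :=
    fun k => by rw [← hgu, Crooked.crookedHalfSpace_eq (hg k)]
  simp only [hH] at hhalf hpair ⊢
  let S : Crooked.SchottkyData m :=
    { g := g
      p := p
      h := h
      g_mem := hg
      h_mem := hh
      disj := fun k l hkl => Crooked.disjoint_closure_halfSpace (hg k) (hg l)
        (by rw [hgu, hgu]; exact hplane k l hkl) (hhalf k l hkl)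
      pair := fun i => by rw [hpair, Crooked.closure_halfSpace, compl_compl] }
  have hX : (⋃ i : Fin m, (closure (Crooked.halfSpace (g (i, true)) (p (i, true))) ∪
      closure (Crooked.halfSpace (g (i, false)) (p (i, false)))))ᶜ = S.X := by
    ext x
    simp only [Crooked.SchottkyData.X, Set.mem_compl_iff, Set.mem_iUnion, Set.mem_union,
      Prod.exists, Bool.exists_bool]
    exact not_congr (exists_congr fun i => or_comm)
  rw [hX]
  exact ⟨S.actsProperlyDiscontinuously, S.isFundamentalDomain, S.lift_injective⟩
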